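/- **Proposition 1.2 (Weak expansion).** Let $d,n\in\mathbb N$, let $V(x)=\tfrac14|x|^4-\tfrac12|x|^2$ on $\mathbb R^d$, and let $(W_t)_{t\ge 0}$ be a standard $d$-dimensional Brownian motion on a probability space. For each $\varepsilon\in(0,1)$ let $\xi_\varepsilon$ be an $\mathbb R^d$-valued random variable independent of $W$, and let $X_\varepsilon$ be a solution with continuous paths of $$dX_\varepsilon(t)=-\nabla V(X_\varepsilon(t))\,dt+\sqrt{2\varepsilon}\,dW_t,\qquad X_\varepsilon(0)=\xi_\varepsilon .$$ Assume that there are random variables $\xi_0,\dots,\xi_n$ such that for every real $p\ge 1$ and $0\le k\le n$ one has $\mathbb E|\xi_k|^{2p}<\infty$ and, for some constant $C(k,p)$ and all $\varepsilon\in(0,1)$, $$\mathbb E\Big|\xi_\varepsilon-\sum_{j=0}^k\varepsilon^{j/2}\xi_j\Big|^{2p}\le C(k,p)\,\varepsilon^{(k+1)p}.$$ For $i,m\ge 1$ let $\mathcal D_i^m$ be the set of $i$-tuples of positive integers with sum $m$. Let $\bar X_0,\dots,\bar X_n$ be processes with continuous paths and $\bar X_m(0)=\xi_m$ that solve, writing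 $A(t)=(1-|\bar X_0(t)|^2)I-2\bar X_0(t)\otimes\bar X_0(t)$, $$d\bar X_0=(\bar X_0-|\bar X_0|^2\bar X_0)\,dt,\qquad d\bar X_1=A\bar X_1\,dt+\sqrt2\,dW_t,$$ and, for $2\le m\le n$, $$d\bar X_m=A\bar X_m\,dt-\sum_{(i,j)\in\mathcal D_2^m}\big[(\bar X_i\cdot\bar X_j)\bar X_0+2(\bar X_i\cdot\bar X_0)\bar X_j\big]dt-\sum_{(i,j,k)\in\mathcal D_3^m}(\bar X_i\cdot\bar X_j)\bar X_k\,dt .$$ Let $F\in C^{n+1}(\mathbb R^d)$ be such that for some $q>0$ and $C$, $\max_{0\le i\le n+1}\|D^iF(x)\|\le C(1+|x|^q)$ for all $x\in\mathbb R^d$. Put $a_0(t,F)=\mathbb E[F(\bar X_0(t))]$ and, for $1\le m\le n$, $$a_m(t,F)=\mathbb E\Big[\sum_{i=1}^m\frac1{i!}\sum_{(j_1,\dots,j_i)\in\mathcal D_i^m}D^iF(\bar X_0(t))\big(\bar X_{j_1}(t),\dots,\bar X_{j_i}(t)\big)\Big].$$ Then for each $t>0$ all these expectations, and $\mathbb E[F(X_\varepsilon(t))]$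 for $\varepsilon\in(0,1)$, are those of integrable random variables, and there is a constant $C(t,n,F)>0$, independent of $\varepsilon$, such that for all $\varepsilon\in(0,1)$ and all $m=0,1,\dots,n$, $$\left|\frac{\mathbb E[F(X_\varepsilon(t))]-\sum_{k=0}^m\varepsilon^{k/2}a_k(t,F)}{\varepsilon^{m/2}}\right|\le C(t,n,F)\,\varepsilon^{1/2}.$$ -/

import Mathlib

open MeasureTheory ProbabilityTheory
open scoped NNReal ENNReal

noncomputable section

namespace DoubleWell

/-- The quartic double-well potential `V(x) = |x|⁴/4 - |x|²/2` on `ℝ^d`. -/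
def potential (d : ℕ) (x : EuclideanSpace ℝ (Fin d)) : ℝ :=
  ‖x‖ ^ 4 / 4 - ‖x‖ ^ 2 / 2

/-- A standard `d`-dimensional Brownian motion: the coordinates are independent one-dimensional
standard Brownian motions (with almost surely continuous paths). -/
structure IsBrownianMotion {d : ℕ} {Ω : Type*} [MeasurableSpace Ω]
    (W : ℝ≥0 → Ω → EuclideanSpace ℝ (Fin d)) (P : Measure Ω) : Prop where
  measurable : ∀ t, Measurable (W t)
  isBrownianReal : ∀ i : Fin d, IsBrownianReal (fun t ω => W t ω i) P
  iIndepFun_coord : iIndepFun (fun (i : Fin d) (ω : Ω) (t : ℝ≥0) => W t ω i) P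

/-- `X` is a stochastic process with almost surely continuous paths which solves
`dX(t) = b(t) dt + σ dW(t)`, `X(0) = ξ`, where `b` is a process (in the applications a function of
`X` and of other processes) and `σ` is a real constant. As the noise is additive, the stochastic
integral `∫₀ᵗ σ dW` is `σ W(t)`, and the equation is its integral form: almost surely, for all
`t ≥ 0`, `X(t) = ξ + ∫₀ᵗ b(s) ds + σ W(t)`. -/
structure SolvesAdditive {d : ℕ} {Ω : Type*} [MeasurableSpace Ω] (P : Measure Ω)
    (W : ℝ≥0 → Ω → EuclideanSpace ℝ (Fin d)) (ξ : Ω → EuclideanSpace ℝ (Fin d))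
    (b : ℝ≥0 → Ω → EuclideanSpace ℝ (Fin d)) (σ : ℝ)
    (X : ℝ≥0 → Ω → EuclideanSpace ℝ (Fin d)) : Prop where
  aemeasurable : ∀ t, AEMeasurable (X t) P
  continuous_paths : ∀ᵐ ω ∂P, Continuous fun t => X t ω
  integral_eq : ∀ᵐ ω ∂P, ∀ t : ℝ≥0,
    X t ω = ξ ω + (∫ s in (0 : ℝ)..t, b s.toNNReal ω) + σ • W t ω

/-- `X` solves `dX = -∇V(X) dt + √(2ε) dW`, `X(0) = ξ`. -/
def SolvesLangevin {d : ℕ} {Ω : Type*} [MeasurableSpace Ω] (P : Measure Ω)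
    (W : ℝ≥0 → Ω → EuclideanSpace ℝ (Fin d)) (ε : ℝ) (ξ : Ω → EuclideanSpace ℝ (Fin d))
    (X : ℝ≥0 → Ω → EuclideanSpace ℝ (Fin d)) : Prop :=
  SolvesAdditive P W ξ (fun t ω => -gradient (potential d) (X t ω)) (Real.sqrt (2 * ε)) X

/-- The set of `i`-tuples of positive integers with sum `m` (used for `i, m ≥ 1`). -/
def compositions (i m : ℕ) : Finset (Fin i → ℕ) :=
  ((Finset.univ : Finset (Fin i)).piAntidiag m).filter fun j => ∀ k, 1 ≤ j k

/-- The vector `[(1 - |x|²) I - 2 x ⊗ x] y`. -/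
def linearizedDrift {d : ℕ} (x y : EuclideanSpace ℝ (Fin d)) : EuclideanSpace ℝ (Fin d) :=
  (1 - ‖x‖ ^ 2) • y - (2 * inner ℝ x y) • x

/-- The drift of the `m`-th fluctuation equation, as a function of the values `x 0, x 1, …` of the
fluctuation coefficients. -/
def coeffDrift {d : ℕ} (x : ℕ → EuclideanSpace ℝ (Fin d)) : ℕ → EuclideanSpace ℝ (Fin d)
  | 0 => x 0 - ‖x 0‖ ^ 2 • x 0
  | 1 => linearizedDrift (x 0) (x 1)
  | m + 2 => linearizedDrift (x 0) (x (m + 2))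
      - ∑ j ∈ compositions 2 (m + 2),
          (inner ℝ (x (j 0)) (x (j 1)) • x 0 + (2 * inner ℝ (x (j 0)) (x 0)) • x (j 1))
      - ∑ j ∈ compositions 3 (m + 2), inner ℝ (x (j 0)) (x (j 1)) • x (j 2)

/-- The coefficient of `dW` in the `m`-th fluctuation equation: `√2` for `m = 1`, otherwise `0`. -/
def coeffNoise (m : ℕ) : ℝ := if m = 1 then Real.sqrt 2 else 0

/-- `Y 0, …, Y n` are the fluctuation coefficients `X̄_0, …, X̄_n` with initial data
`η 0, …, η n`. -/
def SolvesFluctuation {d : ℕ} {Ω : Type*} [MeasurableSpace Ω] (P : Measure Ω)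
    (W : ℝ≥0 → Ω → EuclideanSpace ℝ (Fin d)) (n : ℕ) (η : ℕ → Ω → EuclideanSpace ℝ (Fin d))
    (Y : ℕ → ℝ≥0 → Ω → EuclideanSpace ℝ (Fin d)) : Prop :=
  ∀ m ≤ n, SolvesAdditive P W (η m) (fun t ω => coeffDrift (fun k => Y k t ω) m)
    (coeffNoise m) (Y m)

/-- The asymptotic expansion of the initial data up to order `n`, with coefficients
`η 0, …, η n`: for all real `p ≥ 1` and `0 ≤ k ≤ n`, `E|η k|^{2p} < ∞` and
`E|ξ_ε - ∑_{j ≤ k} ε^{j/2} η j|^{2p} ≤ C(k, p) ε^{(k+1)p}` for every `ε ∈ (0, 1)`. -/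
structure InitialExpansion {d : ℕ} {Ω : Type*} [MeasurableSpace Ω] (P : Measure Ω) (n : ℕ)
    (ξ : ℝ → Ω → EuclideanSpace ℝ (Fin d)) (η : ℕ → Ω → EuclideanSpace ℝ (Fin d)) : Prop where
  measurable : ∀ k ≤ n, Measurable (η k)
  moments : ∀ p : ℝ, 1 ≤ p → ∀ k ≤ n, ∫⁻ ω, ‖η k ω‖ₑ ^ (2 * p) ∂P < ∞
  remainder : ∀ p : ℝ, 1 ≤ p → ∀ k ≤ n, ∃ C : ℝ, ∀ ε ∈ Set.Ioo (0 : ℝ) 1,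
    ∫⁻ ω, ‖ξ ε ω - ∑ j ∈ Finset.range (k + 1), ε ^ ((j : ℝ) / 2) • η j ω‖ₑ ^ (2 * p) ∂P
      ≤ ENNReal.ofReal (C * ε ^ (((k : ℝ) + 1) * p))

/-- `F ∈ C^N(ℝ^d)` and, for some `q > 0`, `‖D^i F(x)‖ ≤ C (1 + |x|^q)` for `0 ≤ i ≤ N`. -/
def HasPolynomialGrowth {d : ℕ} (N : ℕ) (F : EuclideanSpace ℝ (Fin d) → ℝ) : Prop :=
  ContDiff ℝ N F ∧ ∃ q : ℝ, 0 < q ∧ ∃ C : ℝ, ∀ i ≤ N, ∀ x : EuclideanSpace ℝ (Fin d),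
    ‖iteratedFDeriv ℝ i F x‖ ≤ C * (1 + ‖x‖ ^ q)

/-- The random variable whose expectation is `a_m(t, F)`, as a function of the values
`x 0, x 1, …` of the fluctuation coefficients at time `t`. -/
def weakCoeffIntegrand {d : ℕ} (F : EuclideanSpace ℝ (Fin d) → ℝ)
    (x : ℕ → EuclideanSpace ℝ (Fin d)) : ℕ → ℝ
  | 0 => F (x 0)
  | m + 1 => ∑ i ∈ Finset.Icc 1 (m + 1), (1 / (i.factorial : ℝ)) *
      ∑ j ∈ compositions i (m + 1), iteratedFDeriv ℝ i F (x 0) (fun k => x (j k))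

/-- The coefficient `a_m(t, F)` of the weak expansion. -/
def weakCoeff {d : ℕ} {Ω : Type*} [MeasurableSpace Ω] (P : Measure Ω)
    (Y : ℕ → ℝ≥0 → Ω → EuclideanSpace ℝ (Fin d)) (F : EuclideanSpace ℝ (Fin d) → ℝ)
    (m : ℕ) (t : ℝ≥0) : ℝ :=
  ∫ ω, weakCoeffIntegrand F (fun k => Y k t ω) m ∂P

end DoubleWell

end

/-! Write δ = √ε and b(x) = x - |x|²x = -∇V(x).

Monotonicity. The cubic part of b is dissipative, so ⟨b(x) - b(y), x - y⟩ ≤ |x - y|² and ⟨Ay, y⟩ ≤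
|y|². The noise is additive, so subtracting it leaves C¹ paths, and Grönwall costs only the
deterministic factor e^t. All path bounds are therefore polynomial in the initial data and in |W|,
and no exponential moment is needed. By induction on j, |X̄_j(s)| ≤ G + 2|W(s)| on [0, t], where G
has all moments.

Consistency. The drift of the m-th equation is the coefficient of δ^m in b(∑ δ^j x_j)
(`coeffDrift_eq_sub_sum_cubicTerm`). The truncated expansion thus solves the equation of X_ε up to a
residual of order δ^(m+1) with the same noise, and monotonicity gives |X_ε - ∑_{j ≤ m} δ^j X̄_j| ≤
e^t r + δ^(m+1) H, where r is the size of the initial remainder and H has all moments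
(`SolvesLangevin.exists_norm_sub_sum_le`).

Taylor. The remainder divided by δ^(m+1) is treated as one more coefficient, so that X_ε(t) is
exactly a polynomial in δ of degree m + 1. Taylor's formula for F along it has the integrands of
a_0, …, a_m as its first coefficients and an error C δ^(m+1) B^N. The bound B contains e^t r /
δ^(m+1), whose moments are bounded uniformly in ε by the assumption on the initial data. Taking
expectations concludes. -/

namespace DoubleWell

/-! ### Grönwall comparison and one-sided bounds for the drift -/

section DeterministicBounds

section Comparison

variable {E : Type*} [NormedAddCommGroup E] [InnerProductSpace ℝ E]

/-- A Grönwall estimate for curves whose velocity satisfies a one-sided linear bound. -/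
theorem norm_le_exp_mul_of_inner_le [CompleteSpace E] {u v : ℝ → E} {h : ℝ → ℝ} {u₀ : E}
    {T : ℝ} (hT : 0 ≤ T) (hv : Continuous v) (hh : Continuous h) (hh0 : ∀ s, 0 ≤ h s)
    (hu : ∀ s ∈ Set.Icc 0 T, u s = u₀ + ∫ r in (0 : ℝ)..s, v r)
    (hin : ∀ s ∈ Set.Icc 0 T, inner ℝ (v s) (u s) ≤ ‖u s‖ ^ 2 + ‖u s‖ * h s) :
    ‖u T‖ ≤ Real.exp T * (‖u₀‖ + ∫ s in (0 : ℝ)..T, h s) := by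
  -- `u` is controlled on [0, T] only; `U` is differentiable on all of ℝ and agrees with it there.
  set U : ℝ → E := fun s => u₀ + ∫ r in (0 : ℝ)..s, v r with hU
  have hUd : ∀ s, HasDerivAt U (v s) s := fun s =>
    (hv.integral_hasStrictDerivAt 0 s).hasDerivAt.const_add u₀
  have hHd : ∀ s, HasDerivAt (fun s => ∫ r in (0 : ℝ)..s, h r) (h s) s := fun s =>
    (hh.integral_hasStrictDerivAt 0 s).hasDerivAt
  have key : ∀ η : ℝ, 0 < η →
      ‖u T‖ ≤ Real.exp T * (‖u₀‖ + η + ∫ s in (0 : ℝ)..T, h s) := by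
    intro η hη
    -- The regularised norm stays differentiable where `U` vanishes; η tends to 0 at the end.
    set φ : ℝ → ℝ := fun s => Real.sqrt (‖U s‖ ^ 2 + η ^ 2) with hφ
    have hpos : ∀ s, 0 < ‖U s‖ ^ 2 + η ^ 2 := fun s => by positivity
    have hφd : ∀ s, HasDerivAt φ (inner ℝ (v s) (U s) / φ s) s := by
      intro s
      have h1 : HasDerivAt (fun s => ‖U s‖ ^ 2 + η ^ 2) (2 * inner ℝ (U s) (v s)) s :=
        ((hUd s).norm_sq).add_const _
      have h2 := h1.sqrt (hpos s).ne'
      convert h2 using 1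
      rw [real_inner_comm]
      simp only [hφ]
      rw [mul_div_mul_left _ _ (two_ne_zero)]
    -- Since φ' ≤ φ + h, the weighted φ grows at rate at most e^(-s) h ≤ h, which makes ψ
    -- nondecreasing.
    set ψ : ℝ → ℝ := fun s => (∫ r in (0 : ℝ)..s, h r) - Real.exp (-s) * φ s with hψ
    have hψd : ∀ s, HasDerivAt ψ
        (h s - (Real.exp (-s) * (-1) * φ s + Real.exp (-s) * (inner ℝ (v s) (U s) / φ s))) s :=
      fun s => (hHd s).sub (((hasDerivAt_neg s).exp).mul (hφd s))
    have hmono : MonotoneOn ψ (Set.Icc 0 T) := by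
      apply monotoneOn_of_deriv_nonneg (convex_Icc 0 T)
      · exact fun s _ => (hψd s).continuousAt.continuousWithinAt
      · exact fun s _ => (hψd s).differentiableAt.differentiableWithinAt
      · intro s hs
        rw [interior_Icc] at hs
        have hs' : s ∈ Set.Icc 0 T := Set.Ioo_subset_Icc_self hs
        rw [(hψd s).deriv]
        have hus : u s = U s := hu s hs'
        have hi := hin s hs'
        rw [hus] at hi
        have hφpos : 0 < φ s := Real.sqrt_pos.2 (hpos s)
        have hφsq : φ s ^ 2 = ‖U s‖ ^ 2 + η ^ 2 := Real.sq_sqrt (hpos s).le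
        have hle : ‖U s‖ ≤ φ s := Real.le_sqrt_of_sq_le (by nlinarith)
        have hb : inner ℝ (v s) (U s) / φ s ≤ φ s + h s := by
          rw [div_le_iff₀ hφpos]
          nlinarith [mul_le_mul_of_nonneg_right hle (hh0 s), sq_nonneg η]
        have he : Real.exp (-s) ≤ 1 := Real.exp_le_one_iff.2 (by linarith [hs.1])
        have he0 := Real.exp_pos (-s)
        have h3 := mul_le_mul_of_nonneg_left hb he0.le
        have h4 := mul_le_mul_of_nonneg_right he (hh0 s)
        nlinarith
    have h0T := hmono (Set.left_mem_Icc.2 hT) (Set.right_mem_Icc.2 hT) hT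
    simp only [hψ, intervalIntegral.integral_same, neg_zero, Real.exp_zero, one_mul,
      zero_sub] at h0T
    have hφ0 : φ 0 ≤ ‖u₀‖ + η := by
      simp only [hφ, hU, intervalIntegral.integral_same, add_zero]
      apply Real.sqrt_le_iff.2
      refine ⟨by positivity, ?_⟩
      nlinarith [norm_nonneg u₀]
    have hφT : ‖u T‖ ≤ φ T := by
      rw [hu T (Set.right_mem_Icc.2 hT)]
      exact Real.le_sqrt_of_sq_le (by simp only [hU]; nlinarith)
    have h5 : Real.exp (-T) * φ T ≤ ‖u₀‖ + η + ∫ s in (0 : ℝ)..T, h s := by linarith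
    have h6 := mul_le_mul_of_nonneg_left h5 (Real.exp_pos T).le
    rw [← mul_assoc, ← Real.exp_add] at h6
    simp only [add_neg_cancel, Real.exp_zero, one_mul] at h6
    exact hφT.trans h6
  refine le_of_forall_pos_le_add fun e he => ?_
  have := key (e / Real.exp T) (by positivity)
  have h7 : Real.exp T * (e / Real.exp T) = e := by field_simp
  nlinarith

/-- The vector field `x ↦ x - |x|² x`. -/
def drift (x : E) : E := x - ‖x‖ ^ 2 • x

/-- The cubic part contributes -½(|x|² + |y|²)|x - y|² - ½(|x|² - |y|²)², which is nonpositive. -/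
theorem inner_drift_sub_drift_le (x y : E) :
    inner ℝ (drift x - drift y) (x - y) ≤ ‖x - y‖ ^ 2 := by
  have h1 : inner ℝ (drift x - drift y) (x - y)
      = ‖x - y‖ ^ 2 - (‖x‖ ^ 2 * ‖x‖ ^ 2 + ‖y‖ ^ 2 * ‖y‖ ^ 2
        - (‖x‖ ^ 2 + ‖y‖ ^ 2) * inner ℝ x y) := by
    simp only [drift, ← real_inner_self_eq_norm_sq, inner_sub_left, inner_sub_right,
      inner_smul_left, real_inner_comm x y]
    simp
    ring
  have h2 := norm_sub_sq_real x y
  have h3 : 0 ≤ (‖x‖ ^ 2 + ‖y‖ ^ 2) * ‖x - y‖ ^ 2 := by positivity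
  rw [h1]
  nlinarith [sq_nonneg (‖x‖ ^ 2 - ‖y‖ ^ 2)]

end Comparison

theorem drift_continuous {d : ℕ} : Continuous (drift : EuclideanSpace ℝ (Fin d) → _) := by
  unfold drift; fun_prop

theorem gradient_potential {d : ℕ} (x : EuclideanSpace ℝ (Fin d)) :
    gradient (potential d) x = -drift x := by
  apply HasGradientAt.gradient
  rw [hasGradientAt_iff_hasFDerivAt]
  have h1 : HasFDerivAt (fun x : EuclideanSpace ℝ (Fin d) => ‖x‖ ^ 2) (2 • innerSL ℝ x) x :=
    (hasStrictFDerivAt_norm_sq x).hasFDerivAt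
  have h2 : HasFDerivAt (fun x : EuclideanSpace ℝ (Fin d) =>
      (1 / 4 : ℝ) * (‖x‖ ^ 2) ^ 2 - (1 / 2 : ℝ) * ‖x‖ ^ 2) _ x :=
    ((h1.pow 2).const_mul (1 / 4 : ℝ)).sub (h1.const_mul (1 / 2 : ℝ))
  convert! h2 using 1
  · ext y; simp only [potential]; ring
  · ext y
    simp [drift]
    ring

/-- Both terms containing x are dissipative, so the bound does not involve x and Grönwall produces
no exponential of the path X̄_0. -/
theorem inner_linearizedDrift_le {d : ℕ} (x y : EuclideanSpace ℝ (Fin d)) :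
    inner ℝ (linearizedDrift x y) y ≤ ‖y‖ ^ 2 := by
  have h : inner ℝ (linearizedDrift x y) y
      = ‖y‖ ^ 2 - ‖x‖ ^ 2 * ‖y‖ ^ 2 - 2 * (inner ℝ x y) ^ 2 := by
    simp only [linearizedDrift, inner_sub_left, inner_smul_left, ← real_inner_self_eq_norm_sq]
    simp
    ring
  rw [h]
  nlinarith [sq_nonneg (inner ℝ x y), mul_nonneg (sq_nonneg ‖x‖) (sq_nonneg ‖y‖)]

theorem norm_linearizedDrift_le {d : ℕ} (x y : EuclideanSpace ℝ (Fin d)) :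
    ‖linearizedDrift x y‖ ≤ (1 + 3 * ‖x‖ ^ 2) * ‖y‖ := by
  have h1 : ‖linearizedDrift x y‖ ≤ |1 - ‖x‖ ^ 2| * ‖y‖ + 2 * |inner ℝ x y| * ‖x‖ := by
    refine (norm_sub_le _ _).trans ?_
    simp [norm_smul]
  have h2 : |1 - ‖x‖ ^ 2| ≤ 1 + ‖x‖ ^ 2 := by
    rw [abs_le]; constructor <;> nlinarith [sq_nonneg ‖x‖]
  have h3 := abs_real_inner_le_norm x y
  have h4 := mul_le_mul_of_nonneg_right h2 (norm_nonneg y)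
  have h5 := mul_le_mul_of_nonneg_right h3 (norm_nonneg x)
  nlinarith

theorem linearizedDrift_sub {d : ℕ} (x y z : EuclideanSpace ℝ (Fin d)) :
    linearizedDrift x (y - z) = linearizedDrift x y - linearizedDrift x z := by
  simp only [linearizedDrift, inner_sub_right, smul_sub, mul_sub, sub_smul]
  abel

end DeterministicBounds

/-! ### The fluctuation drifts as Taylor coefficients of the cubic field -/

section Coefficients

theorem mem_compositions {i m : ℕ} {j : Fin i → ℕ} :
    j ∈ compositions i m ↔ ∑ k, j k = m ∧ ∀ k, 1 ≤ j k := by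
  simp [compositions]

/-- The box on the right does not depend on m, so sums over m and over tuples can be exchanged. -/
theorem compositions_eq_filter {i m K : ℕ} (hm : m ≤ K) :
    compositions i m
      = (Fintype.piFinset fun _ : Fin i => Finset.Icc 1 K).filter fun j => ∑ k, j k = m := by
  ext j
  simp only [mem_compositions, Finset.mem_filter, Fintype.mem_piFinset, Finset.mem_Icc]
  constructor
  · rintro ⟨h1, h2⟩
    refine ⟨fun k => ⟨h2 k, ?_⟩, h1⟩
    exact ((Finset.single_le_sum (f := j) (fun _ _ => Nat.zero_le _)
      (Finset.mem_univ k)).trans h1.le).trans hm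
  · rintro ⟨h1, h2⟩
    exact ⟨h2, fun k => (h1 k).1⟩

theorem sum_compositions_eq_sum_piFinset {M : Type*} [AddCommMonoid M] {i m K : ℕ} (hm : m ≤ K)
    (f : (Fin i → ℕ) → M) :
    ∑ j ∈ compositions i m, f j
      = ∑ j ∈ Fintype.piFinset fun _ : Fin i => Finset.Icc 1 K,
          if ∑ k, j k = m then f j else 0 := by
  rw [compositions_eq_filter hm, Finset.sum_filter]

theorem sum_compositions_two {M : Type*} [AddCommMonoid M] {m K : ℕ} (hm : m ≤ K)
    (f : ℕ → ℕ → M) :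
    ∑ j ∈ compositions 2 m, f (j 0) (j 1)
      = ∑ a ∈ Finset.Icc 1 K, ∑ b ∈ Finset.Icc 1 K, if a + b = m then f a b else 0 := by
  rw [sum_compositions_eq_sum_piFinset hm (fun j => f (j 0) (j 1)), ← Finset.sum_product']
  refine Finset.sum_nbij' (fun j => (j 0, j 1)) (fun p => ![p.1, p.2]) ?_ ?_ ?_ ?_ ?_
  · intro j hj
    simp only [Fintype.mem_piFinset] at hj
    simp only [Finset.mem_product]
    exact ⟨hj 0, hj 1⟩
  · intro p hp
    simp only [Finset.mem_product] at hp
    simp only [Fintype.mem_piFinset, Fin.forall_fin_two]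
    exact hp
  · intro j _; ext k; fin_cases k <;> rfl
  · intro p _; rfl
  · intro j _; simp [Fin.sum_univ_two]

theorem sum_compositions_three {M : Type*} [AddCommMonoid M] {m K : ℕ} (hm : m ≤ K)
    (f : ℕ → ℕ → ℕ → M) :
    ∑ j ∈ compositions 3 m, f (j 0) (j 1) (j 2)
      = ∑ a ∈ Finset.Icc 1 K, ∑ b ∈ Finset.Icc 1 K, ∑ c ∈ Finset.Icc 1 K,
          if a + b + c = m then f a b c else 0 := by
  rw [sum_compositions_eq_sum_piFinset hm (fun j => f (j 0) (j 1) (j 2))]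
  simp_rw [← Finset.sum_product']
  refine Finset.sum_nbij' (fun j => (j 0, j 1, j 2)) (fun p => ![p.1, p.2.1, p.2.2]) ?_ ?_ ?_ ?_ ?_
  · intro j hj
    simp only [Fintype.mem_piFinset] at hj
    simp only [Finset.mem_product]
    exact ⟨hj 0, hj 1, hj 2⟩
  · intro p hp
    simp only [Finset.mem_product] at hp
    simp only [Fintype.mem_piFinset]
    intro k
    fin_cases k
    exacts [hp.1, hp.2.1, hp.2.2]
  · intro j _; ext k; fin_cases k <;> rfl
  · intro p _; rfl
  · intro j _; simp [Fin.sum_univ_three]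

theorem sum_range_succ_eq_zero_add_Icc {M : Type*} [AddCommMonoid M] (K : ℕ) (f : ℕ → M) :
    ∑ a ∈ Finset.range (K + 1), f a = f 0 + ∑ a ∈ Finset.Icc 1 K, f a := by
  rw [Finset.sum_range_succ', add_comm, Finset.range_eq_Ico, Finset.sum_Ico_add' f 0 K 1]
  rfl

/-- The cubic term `(x i · x j) x l`. -/
noncomputable def cubicTerm {d : ℕ} (x : ℕ → EuclideanSpace ℝ (Fin d)) (i j l : ℕ) :
    EuclideanSpace ℝ (Fin d) :=
  inner ℝ (x i) (x j) • x l

variable {d : ℕ}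

/-- The triples are sorted by their number of zero indices: for m ≥ 2, two zeros give the cubic part
of the linearized drift, one zero the sum over pairs, none the sum over positive triples. -/
theorem coeffDrift_eq_sub_sum_cubicTerm (x : ℕ → EuclideanSpace ℝ (Fin d)) {m K : ℕ}
    (hm : m ≤ K) :
    coeffDrift x m = x m - ∑ a ∈ Finset.range (K + 1), ∑ b ∈ Finset.range (K + 1),
      ∑ c ∈ Finset.range (K + 1), if a + b + c = m then cubicTerm x a b c else 0 := by
  simp_rw [sum_range_succ_eq_zero_add_Icc, Finset.sum_add_distrib]
  have hmem : ∀ k, 1 ≤ k → k ≤ K → k ∈ Finset.Icc 1 K := fun k h1 h2 => Finset.mem_Icc.2 ⟨h1, h2⟩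
  have hz : ∀ a ∈ Finset.Icc 1 K, a ≠ 0 := fun a ha => by
    have := (Finset.mem_Icc.1 ha).1; omega
  match m with
  | 0 =>
    have e1 : ∀ f : ℕ → EuclideanSpace ℝ (Fin d), ∑ a ∈ Finset.Icc 1 K,
        (if a = 0 then f a else 0) = 0 := fun f =>
      Finset.sum_eq_zero fun a ha => if_neg (hz a ha)
    have e2 : ∀ a b : ℕ, a + b = 0 ↔ a = 0 ∧ b = 0 := fun a b => by omega
    simp only [coeffDrift, cubicTerm, e2, ite_and, e1]
    simp +contextual [e1]
  | 1 =>
    have e0 : ∀ f : ℕ → EuclideanSpace ℝ (Fin d), ∑ a ∈ Finset.Icc 1 K,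
        (if a = 1 then f a else 0) = f 1 := fun f => by
      rw [Finset.sum_ite_eq' , if_pos (hmem 1 le_rfl hm)]
    have e2 : ∀ f : ℕ → ℕ → EuclideanSpace ℝ (Fin d), ∑ a ∈ Finset.Icc 1 K,
        ∑ b ∈ Finset.Icc 1 K, (if a + b = 1 then f a b else 0) = 0 := fun f =>
      Finset.sum_eq_zero fun a ha => Finset.sum_eq_zero fun b hb => if_neg (by
        have := hz a ha; have := hz b hb; omega)
    have e3 : ∀ f : ℕ → ℕ → ℕ → EuclideanSpace ℝ (Fin d), ∑ a ∈ Finset.Icc 1 K,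
        ∑ b ∈ Finset.Icc 1 K, ∑ c ∈ Finset.Icc 1 K,
        (if a + b + c = 1 then f a b c else 0) = 0 := fun f =>
      Finset.sum_eq_zero fun a ha => Finset.sum_eq_zero fun b hb =>
        Finset.sum_eq_zero fun c hc => if_neg (by
        have := hz a ha; have := hz b hb; omega)
    simp only [coeffDrift, cubicTerm, linearizedDrift, zero_add, add_zero, e0, e2, e3]
    simp only [zero_ne_one, if_false, zero_add, real_inner_self_eq_norm_sq]
    rw [real_inner_comm (x 0) (x 1)]
    module
  | m + 2 =>
    have e0 : ∀ f : ℕ → EuclideanSpace ℝ (Fin d), ∑ a ∈ Finset.Icc 1 K,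
        (if a = m + 2 then f a else 0) = f (m + 2) := fun f => by
      rw [Finset.sum_ite_eq' , if_pos (hmem _ (by omega) hm)]
    simp only [zero_add, add_zero, e0]
    rw [if_neg (by omega : ¬ (0 = m + 2))]
    rw [coeffDrift, sum_compositions_two hm
      (fun a b => inner ℝ (x a) (x b) • x 0 + (2 * inner ℝ (x a) (x 0)) • x b),
      sum_compositions_three hm (fun a b c => inner ℝ (x a) (x b) • x c)]
    -- The factor 2 counts the zero index in the first or the second position, which give the same
    -- vector.
    have e4 : ∑ a ∈ Finset.Icc 1 K, ∑ b ∈ Finset.Icc 1 K,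
        (if a + b = m + 2 then
          inner ℝ (x a) (x b) • x 0 + (2 * inner ℝ (x a) (x 0)) • x b else 0)
        = (∑ a ∈ Finset.Icc 1 K, ∑ b ∈ Finset.Icc 1 K,
            if a + b = m + 2 then cubicTerm x a b 0 else 0)
          + (∑ a ∈ Finset.Icc 1 K, ∑ b ∈ Finset.Icc 1 K,
            if a + b = m + 2 then cubicTerm x a 0 b else 0)
          + (∑ a ∈ Finset.Icc 1 K, ∑ b ∈ Finset.Icc 1 K,
            if a + b = m + 2 then cubicTerm x 0 a b else 0) := by
      simp_rw [← Finset.sum_add_distrib]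
      refine Finset.sum_congr rfl fun a _ => Finset.sum_congr rfl fun b _ => ?_
      split_ifs
      · simp only [cubicTerm]
        rw [real_inner_comm (x a) (x 0)]
        module
      · simp
    rw [e4]
    simp only [linearizedDrift, cubicTerm, real_inner_self_eq_norm_sq]
    rw [real_inner_comm (x 0) (x (m + 2))]
    module

theorem norm_cubicTerm_le {x : ℕ → EuclideanSpace ℝ (Fin d)} {B : ℝ} {i j l : ℕ}
    (hi : ‖x i‖ ≤ B) (hj : ‖x j‖ ≤ B) (hl : ‖x l‖ ≤ B) : ‖cubicTerm x i j l‖ ≤ B ^ 3 := by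
  have hB : 0 ≤ B := (norm_nonneg _).trans hi
  rw [cubicTerm, norm_smul, Real.norm_eq_abs]
  calc |inner ℝ (x i) (x j)| * ‖x l‖ ≤ (‖x i‖ * ‖x j‖) * ‖x l‖ := by
        gcongr; exact abs_real_inner_le_norm _ _
    _ ≤ (B * B) * B := by gcongr
    _ = B ^ 3 := by ring

/-- The orders up to k cancel by construction of the coefficient drifts; every surviving term
carries at least δ^(k+1). -/
theorem drift_sum_sub_sum_coeffDrift (x : ℕ → EuclideanSpace ℝ (Fin d)) (δ : ℝ) (k : ℕ) :
    drift (∑ j ∈ Finset.range (k + 1), δ ^ j • x j)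
        - ∑ j ∈ Finset.range (k + 1), δ ^ j • coeffDrift x j
      = -∑ a ∈ Finset.range (k + 1), ∑ b ∈ Finset.range (k + 1), ∑ c ∈ Finset.range (k + 1),
          if k < a + b + c then δ ^ (a + b + c) • cubicTerm x a b c else 0 := by
  have h1 : ‖∑ j ∈ Finset.range (k + 1), δ ^ j • x j‖ ^ 2 • ∑ j ∈ Finset.range (k + 1), δ ^ j • x j
      = ∑ a ∈ Finset.range (k + 1), ∑ b ∈ Finset.range (k + 1), ∑ c ∈ Finset.range (k + 1),
          δ ^ (a + b + c) • cubicTerm x a b c := by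
    rw [← real_inner_self_eq_norm_sq, sum_inner]
    simp_rw [inner_sum, Finset.sum_smul, Finset.smul_sum]
    refine Finset.sum_congr rfl fun a _ => Finset.sum_congr rfl fun b _ =>
      Finset.sum_congr rfl fun c _ => ?_
    simp only [inner_smul_left, inner_smul_right, cubicTerm, smul_smul]
    congr 1
    simp [pow_add]
    ring
  have h2 : ∑ j ∈ Finset.range (k + 1), δ ^ j • coeffDrift x j
      = ∑ j ∈ Finset.range (k + 1), δ ^ j • x j
        - ∑ a ∈ Finset.range (k + 1), ∑ b ∈ Finset.range (k + 1), ∑ c ∈ Finset.range (k + 1),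
          if a + b + c ≤ k then δ ^ (a + b + c) • cubicTerm x a b c else 0 := by
    rw [Finset.sum_congr rfl fun j hj => by
      rw [coeffDrift_eq_sub_sum_cubicTerm x (Nat.lt_succ_iff.1 (Finset.mem_range.1 hj))]]
    simp_rw [smul_sub, Finset.sum_sub_distrib]
    congr 1
    simp_rw [Finset.smul_sum]
    rw [Finset.sum_comm]
    refine Finset.sum_congr rfl fun a _ => ?_
    rw [Finset.sum_comm]
    refine Finset.sum_congr rfl fun b _ => ?_
    rw [Finset.sum_comm]
    refine Finset.sum_congr rfl fun c _ => ?_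
    simp_rw [smul_ite, smul_zero]
    rw [Finset.sum_ite_eq]
    simp
  rw [drift, h1, h2]
  rw [sub_sub_sub_cancel_left, ← sub_eq_zero, sub_neg_eq_add]
  simp_rw [← Finset.sum_sub_distrib, ← Finset.sum_add_distrib]
  refine Finset.sum_eq_zero fun a _ => Finset.sum_eq_zero fun b _ => Finset.sum_eq_zero fun c _ => ?_
  split_ifs <;> first | omega | simp

theorem norm_drift_sum_sub_sum_coeffDrift_le {x : ℕ → EuclideanSpace ℝ (Fin d)} {δ B : ℝ} {k : ℕ}
    (hδ : 0 ≤ δ) (hδ1 : δ ≤ 1) (hx : ∀ j ≤ k, ‖x j‖ ≤ B) :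
    ‖drift (∑ j ∈ Finset.range (k + 1), δ ^ j • x j)
        - ∑ j ∈ Finset.range (k + 1), δ ^ j • coeffDrift x j‖
      ≤ ((k : ℝ) + 1) ^ 3 * (δ ^ (k + 1) * B ^ 3) := by
  have hB : 0 ≤ B := (norm_nonneg _).trans (hx 0 (Nat.zero_le _))
  have h0 : 0 ≤ δ ^ (k + 1) * B ^ 3 := by positivity
  have hle : ∀ {a}, a ∈ Finset.range (k + 1) → a ≤ k := fun h =>
    Nat.lt_succ_iff.1 (Finset.mem_range.1 h)
  rw [drift_sum_sub_sum_coeffDrift, norm_neg]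
  have : ((k : ℝ) + 1) ^ 3 * (δ ^ (k + 1) * B ^ 3)
      = ∑ _a ∈ Finset.range (k + 1), ∑ _b ∈ Finset.range (k + 1), ∑ _c ∈ Finset.range (k + 1),
          δ ^ (k + 1) * B ^ 3 := by
    simp only [Finset.sum_const, Finset.card_range, nsmul_eq_mul]
    push_cast; ring
  rw [this]
  refine norm_sum_le_of_le _ fun a ha => norm_sum_le_of_le _ fun b hb =>
    norm_sum_le_of_le _ fun c hc => ?_
  split_ifs with h
  · rw [norm_smul, norm_pow, Real.norm_eq_abs, abs_of_nonneg hδ]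
    exact mul_le_mul (pow_le_pow_of_le_one hδ hδ1 h)
      (norm_cubicTerm_le (hx a (hle ha)) (hx b (hle hb)) (hx c (hle hc)))
      (norm_nonneg _) (by positivity)
  · simpa using h0

theorem norm_drift_sub_drift_le {x y : EuclideanSpace ℝ (Fin d)} {B : ℝ} (hB : 1 ≤ B)
    (hx : ‖x‖ ≤ B) (hy : ‖y‖ ≤ B) : ‖drift x - drift y‖ ≤ 4 * B ^ 2 * ‖x - y‖ := by
  have h1 : drift x - drift y
      = (x - y) - (‖x‖ ^ 2 • (x - y) + ((‖x‖ - ‖y‖) * (‖x‖ + ‖y‖)) • y) := by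
    simp only [drift]; module
  have h2 : |‖x‖ - ‖y‖| ≤ ‖x - y‖ := abs_norm_sub_norm_le x y
  rw [h1]
  calc _ ≤ ‖x - y‖ + (‖x‖ ^ 2 * ‖x - y‖ + |‖x‖ - ‖y‖| * (‖x‖ + ‖y‖) * ‖y‖) := by
        refine (norm_sub_le _ _).trans (add_le_add_right ((norm_add_le _ _).trans ?_) _)
        simp only [norm_smul, norm_mul, norm_pow, Real.norm_eq_abs, abs_norm]
        rw [abs_of_nonneg (by positivity : 0 ≤ ‖x‖ + ‖y‖)]
    _ ≤ B ^ 2 * ‖x - y‖ + (B ^ 2 * ‖x - y‖ + ‖x - y‖ * (B + B) * B) := by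
        gcongr
        exact le_mul_of_one_le_left (norm_nonneg _) (one_le_pow₀ hB)
    _ = 4 * B ^ 2 * ‖x - y‖ := by ring

/-- The part of the drift of the `m`-th equation which is left after the linearized drift acts on
the solution without its noise. -/
theorem exists_norm_coeffDrift_sub_linearizedDrift_le (m : ℕ) (hm : 1 ≤ m) :
    ∃ C : ℝ, 0 ≤ C ∧ ∀ (x : ℕ → EuclideanSpace ℝ (Fin d)) (w : EuclideanSpace ℝ (Fin d)) (B : ℝ),
      1 ≤ B → 2 * ‖w‖ ≤ B → (∀ j < m, ‖x j‖ ≤ B) →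
      ‖coeffDrift x m - linearizedDrift (x 0) (x m - coeffNoise m • w)‖ ≤ C * B ^ 3 := by
  match m with
  | 1 =>
    refine ⟨4, by norm_num, fun x w B hB hw hx => ?_⟩
    have h0 := hx 0 one_pos
    have hs : Real.sqrt 2 ≤ 2 := by
      rw [Real.sqrt_le_left (by norm_num)]; norm_num
    rw [linearizedDrift_sub]
    simp only [coeffDrift, sub_sub_cancel, coeffNoise, if_true]
    refine (norm_linearizedDrift_le _ _).trans ?_
    rw [norm_smul, Real.norm_eq_abs, abs_of_nonneg (Real.sqrt_nonneg _)]
    calc (1 + 3 * ‖x 0‖ ^ 2) * (Real.sqrt 2 * ‖w‖) ≤ (B ^ 2 + 3 * B ^ 2) * (2 * ‖w‖) := by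
          gcongr; exact one_le_pow₀ hB
      _ ≤ (B ^ 2 + 3 * B ^ 2) * B := by gcongr
      _ = 4 * B ^ 3 := by ring
  | m + 2 =>
    refine ⟨3 * (compositions 2 (m + 2)).card + (compositions 3 (m + 2)).card, by positivity,
      fun x w B hB hw hx => ?_⟩
    have hB0 : 0 ≤ B := zero_le_one.trans hB
    -- A tuple with at least two positive entries has all of them below its sum, so only earlier
    -- coefficients occur.
    have hlt : ∀ (i : ℕ) (j : Fin (i + 2) → ℕ), j ∈ compositions (i + 2) (m + 2) →
        ∀ k, ‖x (j k)‖ ≤ B := by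
      intro i j hj k
      apply hx
      obtain ⟨h1, h2⟩ := mem_compositions.1 hj
      obtain ⟨l, hl⟩ := exists_ne k
      have h3 : j k + j l ≤ ∑ k, j k := by
        rw [← Finset.sum_pair hl.symm]
        exact Finset.sum_le_sum_of_subset (Finset.subset_univ _)
      have := h2 l
      omega
    simp only [coeffDrift, coeffNoise, show m + 2 ≠ 1 by omega, if_false, zero_smul, sub_zero]
    rw [show ∀ a b c : EuclideanSpace ℝ (Fin d), a - b - c - a = -(b + c) from
      fun a b c => by abel, norm_neg]
    refine (norm_add_le _ _).trans ?_
    rw [add_mul]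
    refine add_le_add ?_ ?_
    · refine (norm_sum_le_of_le (f := fun j : Fin 2 → ℕ => inner ℝ (x (j 0)) (x (j 1)) • x 0
        + (2 * inner ℝ (x (j 0)) (x 0)) • x (j 1)) (n := fun _ => 3 * B ^ 3) _
        fun j hj => ?_).trans_eq (by simp; ring)
      have hj0 := hlt 0 j hj 0
      have hj1 := hlt 0 j hj 1
      have hx0 := hx 0 (by omega)
      have a1 := norm_cubicTerm_le hj0 hj1 hx0
      have a2 := norm_cubicTerm_le hj0 hx0 hj1
      rw [mul_smul]
      refine (norm_add_le _ _).trans ?_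
      rw [norm_smul (2 : ℝ), Real.norm_eq_abs, abs_two]
      simp only [cubicTerm] at a1 a2
      linarith
    · refine (norm_sum_le_of_le (f := fun j : Fin 3 → ℕ => inner ℝ (x (j 0)) (x (j 1)) • x (j 2))
        (n := fun _ => B ^ 3) _ fun j hj => ?_).trans_eq (by simp)
      exact norm_cubicTerm_le (hlt 1 j hj 0) (hlt 1 j hj 1) (hlt 1 j hj 2)

/-- The expansion up to order `k`; at order `0` the noise of the full equation is included. -/
noncomputable def truncation (x : ℕ → EuclideanSpace ℝ (Fin d)) (w : EuclideanSpace ℝ (Fin d)) (δ : ℝ) (k : ℕ) :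
    EuclideanSpace ℝ (Fin d) :=
  ∑ j ∈ Finset.range (k + 1), δ ^ j • x j + if k = 0 then (δ * Real.sqrt 2) • w else 0

/-- For k ≥ 1 this is the algebraic residual. For k = 0 the only discrepancy is the noise, of size
δ, and the local Lipschitz bound for the drift applies. -/
theorem exists_norm_drift_truncation_sub_le (k : ℕ) :
    ∃ C : ℝ, 0 ≤ C ∧ ∀ (x : ℕ → EuclideanSpace ℝ (Fin d)) (w : EuclideanSpace ℝ (Fin d)) (δ B : ℝ),
      0 ≤ δ → δ ≤ 1 → 1 ≤ B → 2 * ‖w‖ ≤ B → (∀ j ≤ k, ‖x j‖ ≤ B) →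
      ‖drift (truncation x w δ k) - ∑ j ∈ Finset.range (k + 1), δ ^ j • coeffDrift x j‖
        ≤ C * δ ^ (k + 1) * B ^ 3 := by
  by_cases hk : k = 0
  · subst hk
    refine ⟨16, by norm_num, fun x w δ B hδ hδ1 hB hw hx => ?_⟩
    have hs : Real.sqrt 2 ≤ 2 := by
      rw [Real.sqrt_le_left (by norm_num)]; norm_num
    have h0 := hx 0 le_rfl
    have hsw : ‖(δ * Real.sqrt 2) • w‖ ≤ δ * B := by
      rw [norm_smul, norm_mul, Real.norm_eq_abs, Real.norm_eq_abs, abs_of_nonneg hδ,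
        abs_of_nonneg (Real.sqrt_nonneg _), mul_assoc]
      gcongr
      exact (mul_le_mul_of_nonneg_right hs (norm_nonneg _)).trans hw
    have hB0 : 0 ≤ B := zero_le_one.trans hB
    simp only [truncation, zero_add, Finset.sum_range_one, pow_zero, one_smul, if_true, pow_one]
    have := norm_drift_sub_drift_le (x := x 0 + (δ * Real.sqrt 2) • w) (y := x 0) (B := 2 * B)
      (by linarith) ((norm_add_le _ _).trans (by nlinarith)) (by linarith)
    refine this.trans ?_
    rw [add_sub_cancel_left]
    calc 4 * (2 * B) ^ 2 * ‖(δ * Real.sqrt 2) • w‖ ≤ 4 * (2 * B) ^ 2 * (δ * B) := by gcongr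
      _ = _ := by ring
  · refine ⟨((k : ℝ) + 1) ^ 3, by positivity, fun x w δ B hδ hδ1 hB hw hx => ?_⟩
    simp only [truncation, hk, if_false, add_zero]
    rw [mul_assoc]
    exact norm_drift_sum_sub_sum_coeffDrift_le hδ hδ1 hx

/-- The truncation carries exactly the noise of X_ε at every order, so their difference is
noise-free. -/
theorem sum_pow_mul_coeffNoise (δ : ℝ) (k : ℕ) :
    ∑ j ∈ Finset.range (k + 1), δ ^ j * coeffNoise j + (if k = 0 then δ * Real.sqrt 2 else 0)
      = δ * Real.sqrt 2 := by
  cases k with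
  | zero => simp [coeffNoise]
  | succ k =>
    simp only [coeffNoise, mul_ite, mul_zero, Finset.sum_ite_eq', Finset.mem_range]
    simp

end Coefficients

/-! ### Pathwise bounds for the coefficients and the remainder -/

section PathBounds

variable {d : ℕ}

theorem continuous_coeffDrift_path {y : ℕ → ℝ≥0 → EuclideanSpace ℝ (Fin d)} {m : ℕ}
    (hy : ∀ j ≤ m, Continuous (y j)) :
    Continuous fun s : ℝ => coeffDrift (fun k => y k s.toNNReal) m := by
  have hy' : ∀ j ∈ Finset.range (m + 1), Continuous fun s : ℝ => y j s.toNNReal := fun j hj =>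
    (hy j (Nat.lt_succ_iff.1 (Finset.mem_range.1 hj))).comp continuous_real_toNNReal
  simp_rw [coeffDrift_eq_sub_sum_cubicTerm _ le_rfl]
  refine (hy' m (Finset.self_mem_range_succ m)).sub <| continuous_finsetSum _ fun a ha =>
    continuous_finsetSum _ fun b hb => continuous_finsetSum _ fun c hc => ?_
  split_ifs
  · exact ((hy' a ha).inner (𝕜 := ℝ) (hy' b hb)).smul (hy' c hc)
  · exact continuous_const

/-- The integral `∫₀ᵗ (1 + 2|w|)³`, in terms of which all the path bounds are expressed. -/
noncomputable def cubicIntegral (w : ℝ≥0 → EuclideanSpace ℝ (Fin d)) (t : ℝ≥0) : ℝ :=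
  ∫ s in (0 : ℝ)..t, (1 + 2 * ‖w s.toNNReal‖) ^ 3

theorem cubicIntegral_mono {w : ℝ≥0 → EuclideanSpace ℝ (Fin d)} (hw : Continuous w) {s t : ℝ≥0}
    (hst : s ≤ t) : cubicIntegral w s ≤ cubicIntegral w t := by
  have hc : Continuous fun r : ℝ => (1 + 2 * ‖w r.toNNReal‖) ^ 3 := by
    have := hw.comp continuous_real_toNNReal
    fun_prop
  refine intervalIntegral.integral_mono_interval le_rfl s.2 (by exact_mod_cast hst)
    (Filter.Eventually.of_forall fun r => by positivity) (hc.intervalIntegrable _ _)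

theorem norm_le_of_coeff_zero {y : ℕ → ℝ≥0 → EuclideanSpace ℝ (Fin d)}
    {w : ℝ≥0 → EuclideanSpace ℝ (Fin d)} {e : EuclideanSpace ℝ (Fin d)}
    (hy : Continuous (y 0))
    (heq : ∀ t : ℝ≥0, y 0 t = e + (∫ s in (0 : ℝ)..t, coeffDrift (fun k => y k s.toNNReal) 0)
      + coeffNoise 0 • w t) {s t : ℝ≥0} (hst : s ≤ t) :
    ‖y 0 s‖ ≤ Real.exp t * ‖e‖ := by
  have h := norm_le_exp_mul_of_inner_le (u := fun s : ℝ => y 0 s.toNNReal) (h := fun _ => 0)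
    (u₀ := e) (T := s) s.2
    (continuous_coeffDrift_path (m := 0) (fun j hj => by rwa [Nat.le_zero.1 hj])) continuous_const
    (fun _ => le_rfl) (fun r hr => ?_) (fun r hr => ?_)
  · simp only [Real.toNNReal_coe, intervalIntegral.integral_zero, add_zero] at h
    exact h.trans (by gcongr)
  · have := heq r.toNNReal
    rw [Real.coe_toNNReal r hr.1] at this
    simpa [coeffNoise] using this
  · have := inner_drift_sub_drift_le (y 0 r.toNNReal) 0
    simpa [coeffDrift, drift] using this

/-- Separates the time-independent G from the Brownian path, so that G leaves the time integral. -/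
theorem one_add_cube_le {G b : ℝ} (hG : 0 ≤ G) (hb : 0 ≤ b) :
    (1 + G + b) ^ 3 ≤ (1 + G) ^ 3 * (1 + b) ^ 3 := by
  rw [← mul_pow]
  gcongr
  nlinarith [mul_nonneg hG hb]

theorem coeffNoise_nonneg (m : ℕ) : 0 ≤ coeffNoise m := by
  unfold coeffNoise; split_ifs <;> positivity

theorem coeffNoise_le_two (m : ℕ) : coeffNoise m ≤ 2 := by
  unfold coeffNoise
  split_ifs
  · rw [Real.sqrt_le_left (by norm_num)]; norm_num
  · norm_num

/-- Without its noise the m-th coefficient is C¹ and is driven by the linearized drift acting on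
itself plus a cubic residual in the earlier coefficients and w. The conclusion has the same shape as
the assumed bound, a constant plus 2‖w s‖, so it can be iterated in m. -/
theorem exists_norm_le_of_coeff (m : ℕ) (hm : 1 ≤ m) :
    ∃ C : ℝ, 0 ≤ C ∧ ∀ (y : ℕ → ℝ≥0 → EuclideanSpace ℝ (Fin d))
      (w : ℝ≥0 → EuclideanSpace ℝ (Fin d)) (e : EuclideanSpace ℝ (Fin d)) (G : ℝ) (t : ℝ≥0),
      (∀ j ≤ m, Continuous (y j)) → Continuous w →
      (∀ t : ℝ≥0, y m t = e + (∫ s in (0 : ℝ)..t, coeffDrift (fun k => y k s.toNNReal) m)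
        + coeffNoise m • w t) →
      0 ≤ G → (∀ j < m, ∀ s ≤ t, ‖y j s‖ ≤ G + 2 * ‖w s‖) →
      ∀ s ≤ t, ‖y m s‖ ≤ Real.exp t * (‖e‖ + C * (1 + G) ^ 3 * cubicIntegral w t) + 2 * ‖w s‖ := by
  obtain ⟨C, hC, hbound⟩ := exists_norm_coeffDrift_sub_linearizedDrift_le (d := d) m hm
  refine ⟨C, hC, fun y w e G t hy hw heq hG hyG s hst => ?_⟩
  have hw' : Continuous fun r : ℝ => w r.toNNReal := hw.comp continuous_real_toNNReal
  have h := norm_le_exp_mul_of_inner_le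
    (u := fun s : ℝ => y m s.toNNReal - coeffNoise m • w s.toNNReal)
    (h := fun r => C * (1 + G) ^ 3 * (1 + 2 * ‖w r.toNNReal‖) ^ 3)
    (u₀ := e) (T := s) s.2
    (continuous_coeffDrift_path hy) (by fun_prop)
    (fun _ => by positivity) (fun r hr => ?_) (fun r hr => ?_)
  · rw [intervalIntegral.integral_const_mul] at h
    simp only [Real.toNNReal_coe] at h
    have h1 := cubicIntegral_mono hw hst
    have h2 : ‖coeffNoise m • w s‖ ≤ 2 * ‖w s‖ := by
      rw [norm_smul, Real.norm_eq_abs, abs_of_nonneg (coeffNoise_nonneg m)]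
      exact mul_le_mul_of_nonneg_right (coeffNoise_le_two m) (norm_nonneg _)
    have h3 : ‖y m s‖ ≤ ‖y m s - coeffNoise m • w s‖ + ‖coeffNoise m • w s‖ := by
      simpa using norm_add_le (y m s - coeffNoise m • w s) (coeffNoise m • w s)
    have h0 : 0 ≤ cubicIntegral w s :=
      intervalIntegral.integral_nonneg s.2 fun _ _ => by positivity
    refine h3.trans (add_le_add (h.trans ?_) h2)
    rw [show (∫ r in (0 : ℝ)..s, (1 + 2 * ‖w r.toNNReal‖) ^ 3) = cubicIntegral w s from rfl]
    gcongr
  · have := heq r.toNNReal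
    rw [Real.coe_toNNReal r hr.1] at this
    simp only [this]
    abel
  · have hrt : r.toNNReal ≤ t := (Real.toNNReal_le_iff_le_coe.2 hr.2).trans hst
    set x : ℕ → EuclideanSpace ℝ (Fin d) := fun k => y k r.toNNReal with hx
    set v := w r.toNNReal with hv
    have h1 := inner_linearizedDrift_le (x 0) (x m - coeffNoise m • v)
    have h2 := hbound x v (1 + G + 2 * ‖v‖) (by linarith [norm_nonneg v])
      (by linarith) (fun j hj => (hyG j hj _ hrt).trans (by linarith))
    have h3 := real_inner_le_norm
      (coeffDrift x m - linearizedDrift (x 0) (x m - coeffNoise m • v)) (x m - coeffNoise m • v)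
    rw [inner_sub_left] at h3
    have h4 : C * (1 + G + 2 * ‖v‖) ^ 3 ≤ C * (1 + G) ^ 3 * (1 + 2 * ‖v‖) ^ 3 := by
      rw [mul_assoc]
      exact mul_le_mul_of_nonneg_left (one_add_cube_le hG (by positivity)) hC
    have h5 := mul_le_mul_of_nonneg_right (h2.trans h4) (norm_nonneg (x m - coeffNoise m • v))
    change inner ℝ (coeffDrift x m) (x m - coeffNoise m • v) ≤ _
    change _ ≤ ‖x m - coeffNoise m • v‖ ^ 2 + ‖x m - coeffNoise m • v‖ * _
    linarith

/-- The difference is C¹ because the noises cancel. Its velocity is a monotone drift increment plus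
the consistency residual, to which the Grönwall estimate applies. -/
theorem exists_norm_sub_truncation_le (k : ℕ) :
    ∃ C : ℝ, 0 ≤ C ∧ ∀ (X : ℝ≥0 → EuclideanSpace ℝ (Fin d))
      (y : ℕ → ℝ≥0 → EuclideanSpace ℝ (Fin d))
      (w : ℝ≥0 → EuclideanSpace ℝ (Fin d)) (ξ : EuclideanSpace ℝ (Fin d))
      (e : ℕ → EuclideanSpace ℝ (Fin d)) (δ G : ℝ) (t : ℝ≥0),
      0 ≤ δ → δ ≤ 1 → Continuous X → (∀ j ≤ k, Continuous (y j)) → Continuous w →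
      (∀ t : ℝ≥0, X t = ξ + (∫ s in (0 : ℝ)..t, drift (X s.toNNReal))
        + (δ * Real.sqrt 2) • w t) →
      (∀ j ≤ k, ∀ t : ℝ≥0, y j t = e j
        + (∫ s in (0 : ℝ)..t, coeffDrift (fun k => y k s.toNNReal) j) + coeffNoise j • w t) →
      0 ≤ G → (∀ j ≤ k, ∀ s ≤ t, ‖y j s‖ ≤ G + 2 * ‖w s‖) →
      ‖X t - truncation (fun j => y j t) (w t) δ k‖ ≤
        Real.exp t * (‖ξ - ∑ j ∈ Finset.range (k + 1), δ ^ j • e j‖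
          + C * δ ^ (k + 1) * (1 + G) ^ 3 * cubicIntegral w t) := by
  obtain ⟨C, hC, hbound⟩ := exists_norm_drift_truncation_sub_le (d := d) k
  refine ⟨C, hC, fun X y w ξ e δ G t hδ hδ1 hX hy hw hXeq hyeq hG hyG => ?_⟩
  have hle : ∀ {a}, a ∈ Finset.range (k + 1) → a ≤ k := fun h =>
    Nat.lt_succ_iff.1 (Finset.mem_range.1 h)
  have hw' : Continuous fun r : ℝ => w r.toNNReal := hw.comp continuous_real_toNNReal
  have hdX : Continuous fun r : ℝ => drift (X r.toNNReal) :=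
    drift_continuous.comp (hX.comp continuous_real_toNNReal)
  have hdj : ∀ j ∈ Finset.range (k + 1), Continuous fun r : ℝ =>
      δ ^ j • coeffDrift (fun k => y k r.toNNReal) j := fun j hj =>
    (continuous_coeffDrift_path fun i hi => hy i (hi.trans (hle hj))).const_smul (δ ^ j)
  have hdy := continuous_finsetSum _ hdj
  have h := norm_le_exp_mul_of_inner_le
    (u := fun s : ℝ => X s.toNNReal - truncation (fun j => y j s.toNNReal) (w s.toNNReal) δ k)
    (v := fun r => drift (X r.toNNReal) - ∑ j ∈ Finset.range (k + 1),
      δ ^ j • coeffDrift (fun k => y k r.toNNReal) j)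
    (h := fun r => C * δ ^ (k + 1) * (1 + G) ^ 3 * (1 + 2 * ‖w r.toNNReal‖) ^ 3)
    (u₀ := ξ - ∑ j ∈ Finset.range (k + 1), δ ^ j • e j) (T := t) t.2
    (hdX.sub hdy) (by fun_prop)
    (fun _ => by positivity) (fun r hr => ?_) (fun r hr => ?_)
  · rw [intervalIntegral.integral_const_mul] at h
    simpa only [Real.toNNReal_coe, cubicIntegral] using h
  · have h1 : truncation (fun j => y j r.toNNReal) (w r.toNNReal) δ k
        = ∑ j ∈ Finset.range (k + 1), δ ^ j • e j
          + (∫ s in (0 : ℝ)..r, ∑ j ∈ Finset.range (k + 1),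
              δ ^ j • coeffDrift (fun k => y k s.toNNReal) j)
          + (δ * Real.sqrt 2) • w r.toNNReal := by
      rw [intervalIntegral.integral_finsetSum fun j hj => (hdj j hj).intervalIntegrable _ _]
      simp_rw [intervalIntegral.integral_smul]
      rw [← sum_pow_mul_coeffNoise δ k, add_smul, Finset.sum_smul, truncation, ite_smul, zero_smul,
        ← add_assoc, ← Finset.sum_add_distrib, ← Finset.sum_add_distrib]
      congr 1
      refine Finset.sum_congr rfl fun j hj => ?_
      have := hyeq j (hle hj) r.toNNReal
      rw [Real.coe_toNNReal r hr.1] at this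
      rw [this]
      module
    have h2 := hXeq r.toNNReal
    rw [Real.coe_toNNReal r hr.1] at h2
    simp only [h1]
    rw [intervalIntegral.integral_sub (hdX.intervalIntegrable _ _) (hdy.intervalIntegrable _ _), h2]
    abel
  · have hrt : r.toNNReal ≤ t := Real.toNNReal_le_iff_le_coe.2 hr.2
    set x : ℕ → EuclideanSpace ℝ (Fin d) := fun k => y k r.toNNReal with hx
    set v := w r.toNNReal with hv
    set z := X r.toNNReal
    have h1 := inner_drift_sub_drift_le z (truncation x v δ k)
    have h2 := hbound x v δ (1 + G + 2 * ‖v‖) hδ hδ1 (by linarith [norm_nonneg v])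
      (by linarith) (fun j hj => (hyG j hj _ hrt).trans (by linarith))
    have h3 := real_inner_le_norm
      (drift (truncation x v δ k) - ∑ j ∈ Finset.range (k + 1), δ ^ j • coeffDrift x j)
      (z - truncation x v δ k)
    rw [inner_sub_left] at h1 h3
    have h4 : C * δ ^ (k + 1) * (1 + G + 2 * ‖v‖) ^ 3
        ≤ C * δ ^ (k + 1) * (1 + G) ^ 3 * (1 + 2 * ‖v‖) ^ 3 := by
      rw [mul_assoc _ ((1 + G) ^ 3)]
      exact mul_le_mul_of_nonneg_left (one_add_cube_le hG (by positivity)) (by positivity)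
    have h5 := mul_le_mul_of_nonneg_right (h2.trans h4) (norm_nonneg (z - truncation x v δ k))
    change inner ℝ (drift z - ∑ j ∈ Finset.range (k + 1), δ ^ j • coeffDrift x j)
      (z - truncation x v δ k) ≤ ‖z - truncation x v δ k‖ ^ 2 + ‖z - truncation x v δ k‖ * _
    rw [inner_sub_left]
    linarith

end PathBounds

/-! ### Taylor expansion of the observable along a polynomial in δ -/

section TaylorExpansion

variable {d : ℕ}

theorem HasPolynomialGrowth.exists_norm_iteratedFDeriv_le {N : ℕ}
    {F : EuclideanSpace ℝ (Fin d) → ℝ} (hF : HasPolynomialGrowth N F) :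
    ∃ (K : ℝ) (Q : ℕ), 0 ≤ K ∧ ∀ i ≤ N, ∀ (x : EuclideanSpace ℝ (Fin d)) (B : ℝ), 1 ≤ B →
      ‖x‖ ≤ B → ‖iteratedFDeriv ℝ i F x‖ ≤ K * B ^ Q := by
  obtain ⟨-, q, hq, C, hC⟩ := hF
  refine ⟨2 * |C|, ⌈q⌉₊, by positivity, fun i hi x B hB hx => (hC i hi x).trans ?_⟩
  have h1 : ‖x‖ ^ q ≤ B ^ ⌈q⌉₊ := by
    refine (Real.rpow_le_rpow (norm_nonneg _) hx hq.le).trans ?_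
    rw [← Real.rpow_natCast]
    exact Real.rpow_le_rpow_of_exponent_le hB (Nat.le_ceil q)
  have h2 : 1 ≤ B ^ ⌈q⌉₊ := one_le_pow₀ hB
  have h3 : 0 ≤ ‖x‖ ^ q := by positivity
  calc C * (1 + ‖x‖ ^ q) ≤ |C| * (1 + ‖x‖ ^ q) := by gcongr; exact le_abs_self C
    _ ≤ |C| * (B ^ ⌈q⌉₊ + B ^ ⌈q⌉₊) := by gcongr
    _ = _ := by ring

theorem compositions_eq_empty_of_lt {i k : ℕ} (h : k < i) : compositions i k = ∅ := by
  refine Finset.eq_empty_of_forall_notMem fun j hj => ?_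
  obtain ⟨h1, h2⟩ := mem_compositions.1 hj
  have h3 : ∑ _l : Fin i, 1 ≤ ∑ l, j l := Finset.sum_le_sum fun l _ => h2 l
  simp at h3
  omega

/-- The added orders i have no compositions; a range common to all k ≤ m allows the sums to be
exchanged. -/
theorem weakCoeffIntegrand_eq_sum (F : EuclideanSpace ℝ (Fin d) → ℝ)
    (z : ℕ → EuclideanSpace ℝ (Fin d)) {k m : ℕ} (hk : k ≤ m) :
    weakCoeffIntegrand F z k = ∑ i ∈ Finset.range (m + 1), (i.factorial : ℝ)⁻¹ *
      ∑ j ∈ compositions i k, iteratedFDeriv ℝ i F (z 0) (fun l => z (j l)) := by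
  cases k with
  | zero =>
    rw [Finset.sum_eq_single 0]
    · have : compositions 0 0 = Finset.univ := by
        ext j; simpa [mem_compositions] using Subsingleton.elim _ _
      simp [weakCoeffIntegrand, this]
    · intro i _ hi
      rw [compositions_eq_empty_of_lt (Nat.pos_of_ne_zero hi)]
      simp
    · simp
  | succ k =>
    rw [weakCoeffIntegrand]
    simp_rw [one_div]
    refine Finset.sum_subset (fun i hi => ?_) (fun i hi hi' => ?_)
    · rw [Finset.mem_Icc] at hi
      rw [Finset.mem_range]; omega
    · have : compositions i (k + 1) = ∅ := by
        rw [Finset.mem_Icc, not_and_or, not_le, not_le] at hi'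
        rcases hi' with h | h
        · obtain rfl : i = 0 := by omega
          refine Finset.eq_empty_of_forall_notMem fun j hj => ?_
          have := (mem_compositions.1 hj).1
          simp at this
        · exact compositions_eq_empty_of_lt h
      simp [this]

theorem sum_pow_mul_weakCoeffIntegrand (F : EuclideanSpace ℝ (Fin d) → ℝ)
    (z : ℕ → EuclideanSpace ℝ (Fin d)) (δ : ℝ) {m K : ℕ} (hm : m ≤ K) :
    ∑ k ∈ Finset.range (m + 1), δ ^ k * weakCoeffIntegrand F z k
      = ∑ i ∈ Finset.range (m + 1), (i.factorial : ℝ)⁻¹ *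
          ∑ j ∈ Fintype.piFinset fun _ : Fin i => Finset.Icc 1 K,
            if ∑ l, j l ≤ m then δ ^ (∑ l, j l) * iteratedFDeriv ℝ i F (z 0) (fun l => z (j l))
            else 0 := by
  have hle : ∀ {a}, a ∈ Finset.range (m + 1) → a ≤ m := fun h =>
    Nat.lt_succ_iff.1 (Finset.mem_range.1 h)
  rw [Finset.sum_congr rfl fun k hk => by rw [weakCoeffIntegrand_eq_sum F z (hle hk)]]
  simp_rw [Finset.mul_sum]
  rw [Finset.sum_comm]
  refine Finset.sum_congr rfl fun i _ => ?_
  rw [Finset.sum_congr rfl fun k hk => sum_compositions_eq_sum_piFinset ((hle hk).trans hm) _,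
    Finset.sum_comm]
  refine Finset.sum_congr rfl fun j _ => ?_
  rw [Finset.sum_ite_eq]
  simp only [Finset.mem_range, Nat.lt_succ_iff, mul_ite, mul_zero]
  congr 1
  ring

theorem iteratedFDeriv_apply_sum_pow (F : EuclideanSpace ℝ (Fin d) → ℝ)
    (x : EuclideanSpace ℝ (Fin d)) (z : ℕ → EuclideanSpace ℝ (Fin d)) (δ : ℝ) (i K : ℕ) :
    iteratedFDeriv ℝ i F x (fun _ => ∑ j ∈ Finset.Icc 1 K, δ ^ j • z j)
      = ∑ j ∈ Fintype.piFinset fun _ : Fin i => Finset.Icc 1 K,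
          δ ^ (∑ l, j l) * iteratedFDeriv ℝ i F x (fun l => z (j l)) := by
  rw [ContinuousMultilinearMap.map_sum_finset]
  refine Finset.sum_congr rfl fun j _ => ?_
  rw [ContinuousMultilinearMap.map_smul_univ, Finset.prod_pow_eq_pow_sum, smul_eq_mul]

theorem abs_multilinear_apply_le {i : ℕ} {f : ContinuousMultilinearMap ℝ
    (fun _ : Fin i => EuclideanSpace ℝ (Fin d)) ℝ} {v : Fin i → EuclideanSpace ℝ (Fin d)} {A B : ℝ}
    (hf : ‖f‖ ≤ A) (hv : ∀ l, ‖v l‖ ≤ B) : |f v| ≤ A * B ^ i := by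
  have h0 : 0 ≤ A := (norm_nonneg _).trans hf
  refine (f.le_opNorm v).trans ?_
  refine mul_le_mul hf ?_ (Finset.prod_nonneg fun _ _ => norm_nonneg _) h0
  calc ∏ l, ‖v l‖ ≤ ∏ _l : Fin i, B :=
        Finset.prod_le_prod (fun _ _ => norm_nonneg _) fun l _ => hv l
    _ = B ^ i := by simp

/-- Expansion of `F` along a polynomial curve `∑ δ ^ j z j`, up to order `m`. -/
theorem HasPolynomialGrowth.exists_abs_sub_sum_weakCoeffIntegrand_le {n : ℕ}
    {F : EuclideanSpace ℝ (Fin d) → ℝ} (hF : HasPolynomialGrowth (n + 1) F) {m : ℕ} (hm : m ≤ n) :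
    ∃ (C : ℝ) (N : ℕ), 0 ≤ C ∧ ∀ (z : ℕ → EuclideanSpace ℝ (Fin d)) (δ B : ℝ), 0 ≤ δ → δ ≤ 1 →
      1 ≤ B → (∀ j ≤ m + 1, ‖z j‖ ≤ B) →
      |F (∑ j ∈ Finset.range (m + 2), δ ^ j • z j)
          - ∑ k ∈ Finset.range (m + 1), δ ^ k * weakCoeffIntegrand F z k|
        ≤ C * δ ^ (m + 1) * B ^ N := by
  obtain ⟨K, Q, hK, hKQ⟩ := hF.exists_norm_iteratedFDeriv_le
  -- The first sum bounds the Taylor terms of total degree above m in δ; the second term bounds the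
  -- integral remainder, with base point of norm at most (m + 2)B and increment at most δ(m + 1)B.
  refine ⟨(∑ i ∈ Finset.range (m + 1), ∑ _j ∈ Fintype.piFinset fun _ : Fin i =>
      Finset.Icc 1 (m + 1), K) + K * ((m : ℝ) + 2) ^ Q * ((m : ℝ) + 1) ^ (m + 1), Q + (m + 1),
      by positivity, fun z δ B hδ hδ1 hB hz => ?_⟩
  have hB0 : 0 ≤ B := zero_le_one.trans hB
  set h : EuclideanSpace ℝ (Fin d) := ∑ j ∈ Finset.Icc 1 (m + 1), δ ^ j • z j with hh
  have hsum : ∑ j ∈ Finset.range (m + 2), δ ^ j • z j = z 0 + h := by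
    rw [sum_range_succ_eq_zero_add_Icc]; simp [hh]
  have hfac : ∀ i : ℕ, 0 ≤ (i.factorial : ℝ)⁻¹ ∧ (i.factorial : ℝ)⁻¹ ≤ 1 := fun i =>
    ⟨by positivity, inv_le_one_of_one_le₀ (by exact_mod_cast i.factorial_pos)⟩
  have hhn : ‖h‖ ≤ δ * (((m : ℝ) + 1) * B) := by
    refine (norm_sum_le_of_le (n := fun _ => δ * B) _ fun j hj => ?_).trans_eq (by simp; ring)
    rw [Finset.mem_Icc] at hj
    rw [norm_smul, norm_pow, Real.norm_eq_abs, abs_of_nonneg hδ]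
    refine mul_le_mul ?_ (hz j hj.2) (norm_nonneg _) hδ
    simpa using pow_le_pow_of_le_one hδ hδ1 hj.1
  have hT := map_add_eq_sum_add_integral_iteratedFDeriv (f := F) (x := z 0) (y := h) (n := m)
    (fun s _ => (hF.1.of_le (by exact_mod_cast Nat.succ_le_succ hm)).contDiffAt)
  rw [hsum, hT, sum_pow_mul_weakCoeffIntegrand F z δ (Nat.le_succ m), add_sub_right_comm]
  refine (abs_add_le _ _).trans ?_
  rw [add_mul, add_mul]
  refine add_le_add ?_ ?_
  · simp_rw [hh, iteratedFDeriv_apply_sum_pow, smul_eq_mul]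
    rw [← Finset.sum_sub_distrib, Finset.sum_mul, Finset.sum_mul]
    refine (Finset.abs_sum_le_sum_abs _ _).trans (Finset.sum_le_sum fun i hi => ?_)
    rw [← mul_sub, ← Finset.sum_sub_distrib, abs_mul, abs_of_nonneg (hfac i).1]
    refine (mul_le_of_le_one_left (abs_nonneg _) (hfac i).2).trans ?_
    rw [Finset.sum_mul, Finset.sum_mul]
    refine (Finset.abs_sum_le_sum_abs _ _).trans (Finset.sum_le_sum fun j hj => ?_)
    have hi' : i ≤ m := Nat.lt_succ_iff.1 (Finset.mem_range.1 hi)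
    rw [Fintype.mem_piFinset] at hj
    split_ifs with hjm
    · rw [sub_self, abs_zero]; positivity
    · rw [sub_zero, abs_mul, abs_pow, abs_of_nonneg hδ]
      have h1 := abs_multilinear_apply_le (hKQ i (by omega) (z 0) B hB (hz 0 (Nat.zero_le _)))
        (fun l => hz (j l) (Finset.mem_Icc.1 (hj l)).2)
      have h2 : δ ^ (∑ l, j l) ≤ δ ^ (m + 1) := pow_le_pow_of_le_one hδ hδ1 (by omega)
      have h3 : B ^ i ≤ B ^ (m + 1) := pow_le_pow_right₀ hB (by omega)
      calc _ ≤ δ ^ (m + 1) * (K * B ^ Q * B ^ i) := by gcongr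
        _ ≤ δ ^ (m + 1) * (K * B ^ Q * B ^ (m + 1)) := by gcongr
        _ = _ := by ring
  · rw [smul_eq_mul, abs_mul, abs_of_nonneg (hfac m).1]
    refine (mul_le_of_le_one_left (abs_nonneg _) (hfac m).2).trans ?_
    have h1 := intervalIntegral.norm_integral_le_of_norm_le_const (a := (0 : ℝ)) (b := 1)
      (f := fun s : ℝ => (1 - s) ^ m • iteratedFDeriv ℝ (m + 1) F (z 0 + s • h) (fun _ => h))
      (C := K * (((m : ℝ) + 2) * B) ^ Q * (δ * (((m : ℝ) + 1) * B)) ^ (m + 1)) (fun s hs => ?_)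
    · rw [Real.norm_eq_abs] at h1
      refine h1.trans_eq ?_
      rw [mul_pow, mul_pow, mul_pow, sub_zero, abs_one]
      ring
    · rw [Set.uIoc_of_le zero_le_one] at hs
      have hx : ‖z 0 + s • h‖ ≤ ((m : ℝ) + 2) * B := by
        refine (norm_add_le _ _).trans ?_
        have h2 : ‖s • h‖ ≤ 1 * (1 * (((m : ℝ) + 1) * B)) := by
          rw [norm_smul, Real.norm_eq_abs, abs_of_nonneg hs.1.le]
          refine mul_le_mul hs.2 (hhn.trans ?_) (norm_nonneg _) zero_le_one
          gcongr
        linarith [hz 0 (Nat.zero_le _)]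
      have h2 := abs_multilinear_apply_le (hKQ (m + 1) (by omega) _ _
        (by nlinarith [(Nat.cast_nonneg m : (0 : ℝ) ≤ m)]) hx) (fun _ : Fin (m + 1) => hhn)
      rw [norm_smul, Real.norm_eq_abs, Real.norm_eq_abs, abs_of_nonneg (pow_nonneg (by linarith [hs.2]) _)]
      refine (mul_le_of_le_one_left (abs_nonneg _) ?_).trans h2
      exact pow_le_one₀ (by linarith [hs.2]) (by linarith [hs.1])

theorem continuous_weakCoeffIntegrand {n m : ℕ} {F : EuclideanSpace ℝ (Fin d) → ℝ}
    (hF : ContDiff ℝ n F) (hm : m ≤ n) : Continuous fun z => weakCoeffIntegrand F z m := by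
  simp_rw [weakCoeffIntegrand_eq_sum F _ le_rfl]
  refine continuous_finsetSum _ fun i hi => continuous_const.mul <|
    continuous_finsetSum _ fun j _ => ?_
  have hi' : i ≤ n := (Nat.lt_succ_iff.1 (Finset.mem_range.1 hi)).trans hm
  have h1 : Continuous (iteratedFDeriv ℝ i F) := hF.continuous_iteratedFDeriv (by exact_mod_cast hi')
  have h2 := h1.comp (continuous_apply 0 : Continuous fun z : ℕ → EuclideanSpace ℝ (Fin d) => z 0)
  exact h2.eval (continuous_pi fun l => continuous_apply (j l))

theorem HasPolynomialGrowth.exists_abs_weakCoeffIntegrand_le {n : ℕ}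
    {F : EuclideanSpace ℝ (Fin d) → ℝ} (hF : HasPolynomialGrowth (n + 1) F) {m : ℕ} (hm : m ≤ n) :
    ∃ (C : ℝ) (N : ℕ), 0 ≤ C ∧ ∀ (z : ℕ → EuclideanSpace ℝ (Fin d)) (B : ℝ),
      1 ≤ B → (∀ j ≤ m, ‖z j‖ ≤ B) → |weakCoeffIntegrand F z m| ≤ C * B ^ N := by
  obtain ⟨K, Q, hK, hKQ⟩ := hF.exists_norm_iteratedFDeriv_le
  refine ⟨∑ i ∈ Finset.range (m + 1), ∑ _j ∈ compositions i m, K, Q + m, by positivity,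
    fun z B hB hz => ?_⟩
  have hB0 : 0 ≤ B := zero_le_one.trans hB
  rw [weakCoeffIntegrand_eq_sum F z le_rfl, Finset.sum_mul]
  refine (Finset.abs_sum_le_sum_abs _ _).trans (Finset.sum_le_sum fun i hi => ?_)
  have hi' : i ≤ m := Nat.lt_succ_iff.1 (Finset.mem_range.1 hi)
  rw [abs_mul, abs_of_nonneg (by positivity)]
  refine (mul_le_of_le_one_left (abs_nonneg _)
    (inv_le_one_of_one_le₀ (by exact_mod_cast i.factorial_pos))).trans ?_
  rw [Finset.sum_mul]
  refine (Finset.abs_sum_le_sum_abs _ _).trans (Finset.sum_le_sum fun j hj => ?_)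
  obtain ⟨h1, -⟩ := mem_compositions.1 hj
  have h2 := abs_multilinear_apply_le (hKQ i (by omega) (z 0) B hB (hz 0 (Nat.zero_le _)))
    (fun l => hz (j l) (h1 ▸ Finset.single_le_sum (f := j) (fun _ _ => Nat.zero_le _)
      (Finset.mem_univ l)))
  refine h2.trans ?_
  rw [mul_assoc, ← pow_add]
  gcongr

end TaylorExpansion

/-! ### Random variables with all moments -/

section Moments

variable {Ω : Type*} [MeasurableSpace Ω] {P : Measure Ω}

/-- All the moments of `U` are finite. -/
def HasAllMoments (U : Ω → ℝ) (P : Measure Ω) : Prop := ∀ p : ℕ, MemLp U p P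

namespace HasAllMoments

variable {U V : Ω → ℝ}

/-- On a finite measure space it suffices to check large exponents, which avoids those not covered
by the available bounds. -/
theorem of_memLp_add [IsFiniteMeasure P] (k : ℕ) (h : ∀ p : ℕ, MemLp U (p + k : ℕ) P) :
    HasAllMoments U P :=
  fun p => (h p).mono_exponent (by exact_mod_cast Nat.le_add_right p k)

theorem add (hU : HasAllMoments U P) (hV : HasAllMoments V P) :
    HasAllMoments (fun ω => U ω + V ω) P := fun p => (hU p).add (hV p)

theorem mul (hU : HasAllMoments U P) (hV : HasAllMoments V P) :
    HasAllMoments (fun ω => U ω * V ω) P := fun p => by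
  have : ENNReal.HolderTriple ((2 * p : ℕ) : ℝ≥0∞) ((2 * p : ℕ) : ℝ≥0∞) (p : ℝ≥0∞) := by
    constructor
    push_cast
    rw [ENNReal.mul_inv (by simp) (by simp), ← add_mul, ENNReal.inv_two_add_inv_two, one_mul]
  exact MemLp.mul' (hV (2 * p)) (hU (2 * p))

theorem const [IsFiniteMeasure P] (c : ℝ) : HasAllMoments (fun _ : Ω => c) P :=
  fun _ => memLp_const c

theorem const_mul (c : ℝ) (hU : HasAllMoments U P) : HasAllMoments (fun ω => c * U ω) P :=
  fun p => (hU p).const_mul c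

theorem pow [IsFiniteMeasure P] (hU : HasAllMoments U P) (k : ℕ) :
    HasAllMoments (fun ω => U ω ^ k) P := by
  induction k with
  | zero => simpa using const (P := P) 1
  | succ k ih => simpa only [pow_succ] using ih.mul hU

theorem integrable (hU : HasAllMoments U P) : Integrable U P := by
  have := hU 1
  rwa [Nat.cast_one, memLp_one_iff_integrable] at this

theorem congr (hU : HasAllMoments U P) (h : U =ᵐ[P] V) : HasAllMoments V P :=
  fun p => (hU p).ae_eq h

end HasAllMoments

/-- An integral over a finite measure space of functions with uniformly bounded moments. -/
theorem hasAllMoments_integral [IsFiniteMeasure P] {S : Type*} [MeasurableSpace S] {ν : Measure S}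
    [IsFiniteMeasure ν] {f : S → Ω → ℝ} (hf : Measurable (Function.uncurry f))
    (hbound : ∀ p : ℕ, ∃ M : ℝ≥0∞, M < ∞ ∧
      ∀ᵐ s ∂ν, ∫⁻ ω, ‖f s ω‖ₑ ^ (p + 1) ∂P ≤ M) :
    HasAllMoments (fun ω => ∫ s, f s ω ∂ν) P := by
  refine HasAllMoments.of_memLp_add 1 fun p => ?_
  have hm : StronglyMeasurable fun ω => ∫ s, f s ω ∂ν :=
    (hf.comp measurable_swap).stronglyMeasurable.integral_prod_right' (f := fun q : Ω × S =>
      f q.2 q.1)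
  refine ⟨hm.aestronglyMeasurable, ?_⟩
  obtain ⟨M, hM, hbM⟩ := hbound p
  have hp0 : ((p + 1 : ℕ) : ℝ≥0∞) ≠ 0 := by exact_mod_cast Nat.succ_ne_zero p
  rw [eLpNorm_lt_top_iff_lintegral_rpow_enorm_lt_top hp0 (ENNReal.natCast_ne_top _)]
  simp only [ENNReal.toReal_natCast, ENNReal.rpow_natCast]
  set K : ℝ≥0∞ := ν Set.univ ^ (1 / (1 : ℝ≥0∞).toReal - 1 / ((p + 1 : ℕ) : ℝ≥0∞).toReal) with hK
  have hKtop : K < ∞ := by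
    refine ENNReal.rpow_lt_top_of_nonneg ?_ (measure_ne_top _ _)
    simp only [ENNReal.toReal_one, ENNReal.toReal_natCast, one_div_one, sub_nonneg]
    rw [div_le_one (by positivity)]
    exact_mod_cast Nat.succ_pos p
  -- Hölder in s, with K a power of the total mass of ν; Tonelli then exchanges the integrals.
  have hω : ∀ ω, ‖∫ s, f s ω ∂ν‖ₑ ^ (p + 1) ≤ (∫⁻ s, ‖f s ω‖ₑ ^ (p + 1) ∂ν) * K ^ (p + 1) := by
    intro ω
    have hms : AEStronglyMeasurable (fun s => f s ω) ν :=
      (hf.comp measurable_prodMk_right).aestronglyMeasurable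
    have h1 := eLpNorm_le_eLpNorm_mul_rpow_measure_univ (p := 1) (q := ((p + 1 : ℕ) : ℝ≥0∞))
      (by exact_mod_cast Nat.succ_pos p) hms
    rw [eLpNorm_one_eq_lintegral_enorm] at h1
    have h2 := (enorm_integral_le_lintegral_enorm (μ := ν) fun s => f s ω).trans h1
    refine (pow_le_pow_left' h2 (p + 1)).trans_eq ?_
    rw [mul_pow]
    congr 1
    have := eLpNorm_nnreal_pow_eq_lintegral (f := fun s => f s ω) (μ := ν) (p := ((p + 1 : ℕ) : ℝ≥0))
      (by exact_mod_cast Nat.succ_ne_zero p)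
    simpa only [NNReal.coe_natCast, ENNReal.rpow_natCast, ENNReal.coe_natCast] using this
  have hme : Measurable (Function.uncurry fun (ω : Ω) (s : S) => ‖f s ω‖ₑ ^ (p + 1)) :=
    (hf.comp measurable_swap).enorm.pow_const _
  calc ∫⁻ ω, ‖∫ s, f s ω ∂ν‖ₑ ^ (p + 1) ∂P
      ≤ ∫⁻ ω, (∫⁻ s, ‖f s ω‖ₑ ^ (p + 1) ∂ν) * K ^ (p + 1) ∂P := lintegral_mono hω
    _ = (∫⁻ s, ∫⁻ ω, ‖f s ω‖ₑ ^ (p + 1) ∂P ∂ν) * K ^ (p + 1) := by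
        rw [lintegral_mul_const' _ _ (ENNReal.pow_ne_top hKtop.ne),
          lintegral_lintegral_swap hme.aemeasurable]
    _ ≤ (∫⁻ _s, M ∂ν) * K ^ (p + 1) := mul_le_mul_left (lintegral_mono_ae hbM) _
    _ < ∞ := by
        rw [lintegral_const]
        exact ENNReal.mul_lt_top (ENNReal.mul_lt_top hM (measure_lt_top _ _))
          (ENNReal.pow_lt_top hKtop)

/-! ### Moments of Brownian motion and of its cubic time integral -/

section BrownianMotion

variable {d : ℕ} {W : ℝ≥0 → Ω → EuclideanSpace ℝ (Fin d)}

theorem IsBrownianMotion.ae_continuous (hW : IsBrownianMotion W P) :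
    ∀ᵐ ω ∂P, Continuous fun t => W t ω := by
  have h : ∀ᵐ ω ∂P, ∀ i, Continuous fun t => W t ω i :=
    ae_all_iff.2 fun i => (hW.isBrownianReal i).cont
  filter_upwards [h] with ω hω
  exact (PiLp.continuous_toLp 2 _).comp (continuous_pi hω)

/-- Brownian scaling: a centred Gaussian of variance s is √s times a standard one, which gives
uniformity in s ≤ t. -/
theorem eLpNorm_id_gaussianReal_le (p : ℝ≥0∞) {s t : ℝ≥0} (hst : s ≤ t) :
    eLpNorm id p (gaussianReal 0 s)
      ≤ ENNReal.ofReal (Real.sqrt t) * eLpNorm id p (gaussianReal 0 1) := by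
  have h1 : gaussianReal 0 s = (gaussianReal 0 1).map (Real.sqrt s * ·) := by
    rw [gaussianReal_map_const_mul]
    congr 1
    · simp
    · ext; simp
  rw [h1, eLpNorm_map_measure aestronglyMeasurable_id (by fun_prop)]
  have h2 : (id ∘ fun x : ℝ => Real.sqrt s * x) = Real.sqrt s • (id : ℝ → ℝ) := by
    ext x; simp
  rw [h2, eLpNorm_const_smul]
  gcongr
  rw [Real.enorm_eq_ofReal (Real.sqrt_nonneg _)]
  exact ENNReal.ofReal_le_ofReal (Real.sqrt_le_sqrt (by exact_mod_cast hst))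

theorem IsBrownianMotion.exists_eLpNorm_le (hW : IsBrownianMotion W P) [IsProbabilityMeasure P]
    (t : ℝ≥0) (p : ℕ) :
    ∃ M : ℝ≥0∞, M < ∞ ∧ ∀ s ≤ t, eLpNorm (fun ω => 1 + 2 * ‖W s ω‖) (p + 1 : ℕ) P ≤ M := by
  set q : ℝ≥0∞ := ((p + 1 : ℕ) : ℝ≥0∞) with hq
  have hq1 : 1 ≤ q := by rw [hq]; exact_mod_cast Nat.succ_pos p
  refine ⟨eLpNorm (fun _ : Ω => (1 : ℝ)) q P + ‖(2 : ℝ)‖ₑ * ∑ _i : Fin d,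
    (ENNReal.ofReal (Real.sqrt t) * eLpNorm id q (gaussianReal 0 1)), ?_, fun s hs => ?_⟩
  · refine ENNReal.add_lt_top.2 ⟨(memLp_const 1).2, ENNReal.mul_lt_top (by simp) ?_⟩
    exact ENNReal.sum_lt_top.2 fun i _ => ENNReal.mul_lt_top ENNReal.ofReal_lt_top
      (memLp_id_gaussianReal' q (by simp [hq])).2
  · have hm : ∀ i, Measurable fun ω => W s ω i := fun i => by
      have := hW.measurable s
      fun_prop
    have h1 : eLpNorm (fun ω => ‖W s ω‖) q P ≤ eLpNorm (∑ i : Fin d, fun ω => ‖W s ω i‖) q P := by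
      refine eLpNorm_mono_real fun ω => ?_
      rw [norm_norm, Finset.sum_apply]
      have h := norm_sum_le Finset.univ fun i => W s ω i • EuclideanSpace.basisFun (Fin d) ℝ i
      have h3 : ∑ i, W s ω i • EuclideanSpace.basisFun (Fin d) ℝ i = W s ω := by
        simpa using (EuclideanSpace.basisFun (Fin d) ℝ).sum_repr (W s ω)
      rw [h3] at h
      refine h.trans_eq (Finset.sum_congr rfl fun i _ => ?_)
      rw [norm_smul, OrthonormalBasis.norm_eq_one, mul_one]
    have h2 : ∀ i, eLpNorm (fun ω => ‖W s ω i‖) q P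
        ≤ ENNReal.ofReal (Real.sqrt t) * eLpNorm id q (gaussianReal 0 1) := fun i => by
      rw [eLpNorm_norm]
      have hlaw := (hW.isBrownianReal i).hasLaw_eval s
      refine le_trans (le_of_eq ?_) (eLpNorm_id_gaussianReal_le q hs)
      rw [← hlaw.map_eq, eLpNorm_map_measure aestronglyMeasurable_id (hm i).aemeasurable]
      rfl
    refine (eLpNorm_add_le (f := fun _ : Ω => (1 : ℝ)) (g := fun ω => 2 * ‖W s ω‖)
      aestronglyMeasurable_const ((hW.measurable s).norm.const_mul 2).aestronglyMeasurable
      hq1).trans ?_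
    have h4 : (fun ω => 2 * ‖W s ω‖) = (2 : ℝ) • fun ω => ‖W s ω‖ := rfl
    rw [h4, eLpNorm_const_smul]
    gcongr
    refine h1.trans ((eLpNorm_sum_le (fun i _ => (hm i).norm.aestronglyMeasurable) hq1).trans ?_)
    exact Finset.sum_le_sum fun i _ => h2 i

theorem IsBrownianMotion.hasAllMoments_norm [IsProbabilityMeasure P] (hW : IsBrownianMotion W P)
    (t : ℝ≥0) : HasAllMoments (fun ω => 1 + 2 * ‖W t ω‖) P :=
  HasAllMoments.of_memLp_add 1 fun p => by
    obtain ⟨M, hM, h⟩ := hW.exists_eLpNorm_le t p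
    exact ⟨(((hW.measurable t).norm.const_mul 2).const_add 1).aestronglyMeasurable,
      (h t le_rfl).trans_lt hM⟩

theorem IsBrownianMotion.hasAllMoments_cubicIntegral [IsProbabilityMeasure P]
    (hW : IsBrownianMotion W P) (t : ℝ≥0) :
    HasAllMoments (fun ω => cubicIntegral (fun s => W s ω) t) P := by
  classical
  have hcont : ∀ᵐ ω ∂P, ω ∉ toMeasurable P {ω | ¬ Continuous fun t => W t ω} := by
    rw [ae_iff]
    simpa [measure_toMeasurable, ae_iff] using hW.ae_continuous
  set S := toMeasurable P {ω | ¬ Continuous fun t => W t ω} with hS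
  have hSm : MeasurableSet S := measurableSet_toMeasurable _ _
  -- Paths are continuous only almost surely. Setting W to 0 on a measurable null set makes every
  -- path continuous, hence the process jointly measurable.
  set W' : ℝ≥0 → Ω → EuclideanSpace ℝ (Fin d) := fun s ω => if ω ∈ S then 0 else W s ω with hW'
  have hae : ∀ s, W' s =ᵐ[P] W s := fun s => by
    filter_upwards [hcont] with ω hω
    simp only [hW', if_neg hω]
  have hmeas : Measurable (Function.uncurry W') := by
    refine measurable_uncurry_of_continuous_of_measurable (fun ω => ?_) fun s =>
      Measurable.ite hSm measurable_const (hW.measurable s)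
    by_cases hω : ω ∈ S
    · simp only [hW', if_pos hω]; exact continuous_const
    · simp only [hW', if_neg hω]
      by_contra hc
      exact hω (subset_toMeasurable P _ hc)
  have hf : Measurable (Function.uncurry fun (s : ℝ) (ω : Ω) =>
      (1 + 2 * ‖W' s.toNNReal ω‖) ^ 3) := by
    have : Measurable fun q : ℝ × Ω => W' q.1.toNNReal q.2 :=
      hmeas.comp ((measurable_real_toNNReal.comp measurable_fst).prodMk measurable_snd)
    exact ((this.norm.const_mul 2).const_add 1).pow_const 3
  have h := hasAllMoments_integral (P := P) (ν := volume.restrict (Set.Ioc (0 : ℝ) t)) hf ?_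
  · refine h.congr ?_
    filter_upwards [hcont] with ω hω
    simp only [hW', if_neg hω, cubicIntegral]
    exact (intervalIntegral.integral_of_le t.2).symm
  · intro p
    -- The (p + 1)-th power of a cube has exponent 3p + 3 = (3p + 2) + 1.
    obtain ⟨M, hM, hle⟩ := hW.exists_eLpNorm_le t (3 * p + 2)
    refine ⟨M ^ (3 * p + 3), ENNReal.pow_lt_top hM, ?_⟩
    refine (ae_restrict_iff' measurableSet_Ioc).2 (Filter.Eventually.of_forall fun s hs => ?_)
    have h1 := hle s.toNNReal (Real.toNNReal_le_iff_le_coe.2 hs.2)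
    have h2 := eLpNorm_nnreal_pow_eq_lintegral (f := fun ω => 1 + 2 * ‖W s.toNNReal ω‖) (μ := P)
      (p := ((3 * p + 3 : ℕ) : ℝ≥0)) (by positivity)
    simp only [NNReal.coe_natCast, ENNReal.rpow_natCast, ENNReal.coe_natCast] at h2
    calc ∫⁻ ω, ‖(1 + 2 * ‖W' s.toNNReal ω‖) ^ 3‖ₑ ^ (p + 1) ∂P
        = ∫⁻ ω, ‖1 + 2 * ‖W s.toNNReal ω‖‖ₑ ^ (3 * p + 3) ∂P := by
          refine lintegral_congr_ae ?_
          filter_upwards [hae s.toNNReal] with ω hω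
          rw [hω, enorm_pow, ← pow_mul]
          ring_nf
      _ ≤ M ^ (3 * p + 3) := by
          rw [← h2]
          exact pow_le_pow_left' h1 _

end BrownianMotion

end Moments

/-! ### Probabilistic estimates and the weak expansion -/

section WeakExpansion

variable {d : ℕ} {Ω : Type*} [MeasurableSpace Ω] {P : Measure Ω}

theorem weakCoeffIntegrand_congr (F : EuclideanSpace ℝ (Fin d) → ℝ)
    {z z' : ℕ → EuclideanSpace ℝ (Fin d)} {m : ℕ} (h : ∀ j ≤ m, z j = z' j) :
    weakCoeffIntegrand F z m = weakCoeffIntegrand F z' m := by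
  rw [weakCoeffIntegrand_eq_sum F z le_rfl, weakCoeffIntegrand_eq_sum F z' le_rfl,
    h 0 (Nat.zero_le m)]
  refine Finset.sum_congr rfl fun i _ => ?_
  congr 1
  refine Finset.sum_congr rfl fun j hj => ?_
  congr 1
  ext1 l
  rw [h]
  exact (mem_compositions.1 hj).1 ▸
    Finset.single_le_sum (f := j) (fun _ _ => Nat.zero_le _) (Finset.mem_univ l)

theorem rpow_half_eq_sqrt_pow {ε : ℝ} (hε : 0 ≤ ε) (j : ℕ) :
    ε ^ ((j : ℝ) / 2) = Real.sqrt ε ^ j := by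
  rw [Real.sqrt_eq_rpow, ← Real.rpow_natCast, ← Real.rpow_mul hε]
  congr 1
  ring

theorem cubicIntegral_nonneg (w : ℝ≥0 → EuclideanSpace ℝ (Fin d)) (t : ℝ≥0) :
    0 ≤ cubicIntegral w t :=
  intervalIntegral.integral_nonneg t.2 fun _ _ => by positivity

theorem InitialExpansion.hasAllMoments_norm [IsProbabilityMeasure P] {n : ℕ}
    {ξ : ℝ → Ω → EuclideanSpace ℝ (Fin d)} {η : ℕ → Ω → EuclideanSpace ℝ (Fin d)}
    (hη : InitialExpansion P n ξ η) {k : ℕ} (hk : k ≤ n) :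
    HasAllMoments (fun ω => ‖η k ω‖) P :=
  HasAllMoments.of_memLp_add 2 fun p => by
    refine ⟨(hη.measurable k hk).norm.aestronglyMeasurable, ?_⟩
    rw [eLpNorm_lt_top_iff_lintegral_rpow_enorm_lt_top
      (by exact_mod_cast Nat.succ_ne_zero (p + 1)) (ENNReal.natCast_ne_top _)]
    have := hη.moments (((p : ℝ) + 2) / 2) (by linarith [(Nat.cast_nonneg p : (0 : ℝ) ≤ p)]) k hk
    simp only [enorm_norm, ENNReal.toReal_natCast]
    convert! this using 5
    push_cast
    ring

theorem InitialExpansion.exists_integral_norm_pow_le {n : ℕ}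
    {ξ : ℝ → Ω → EuclideanSpace ℝ (Fin d)} {η : ℕ → Ω → EuclideanSpace ℝ (Fin d)}
    (hη : InitialExpansion P n ξ η) (hξ : ∀ ε ∈ Set.Ioo (0 : ℝ) 1, Measurable (ξ ε))
    {k : ℕ} (hk : k ≤ n) (p : ℕ) :
    ∃ C : ℝ, 0 ≤ C ∧ ∀ ε ∈ Set.Ioo (0 : ℝ) 1,
      Integrable (fun ω => ‖ξ ε ω - ∑ j ∈ Finset.range (k + 1), Real.sqrt ε ^ j • η j ω‖ ^ (p + 2))
        P ∧
      ∫ ω, ‖ξ ε ω - ∑ j ∈ Finset.range (k + 1), Real.sqrt ε ^ j • η j ω‖ ^ (p + 2) ∂P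
        ≤ C * (Real.sqrt ε ^ (k + 1)) ^ (p + 2) := by
  -- The exponent 2 · (p + 2)/2 = p + 2; the shift by 2 keeps the parameter at least 1.
  obtain ⟨C, hC⟩ := hη.remainder (((p : ℝ) + 2) / 2)
    (by linarith [(Nat.cast_nonneg p : (0 : ℝ) ≤ p)]) k hk
  refine ⟨|C|, abs_nonneg C, fun ε hε => ?_⟩
  set r : Ω → EuclideanSpace ℝ (Fin d) := fun ω =>
    ξ ε ω - ∑ j ∈ Finset.range (k + 1), Real.sqrt ε ^ j • η j ω with hr
  have hrm : Measurable r := (hξ ε hε).sub <| Finset.measurable_sum _ fun j hj =>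
    (hη.measurable j ((Nat.lt_succ_iff.1 (Finset.mem_range.1 hj)).trans hk)).const_smul
      (Real.sqrt ε ^ j)
  have hpow : ε ^ (((k : ℝ) + 1) * (((p : ℝ) + 2) / 2)) = (Real.sqrt ε ^ (k + 1)) ^ (p + 2) := by
    rw [← pow_mul, ← rpow_half_eq_sqrt_pow hε.1.le]
    congr 1
    push_cast
    ring
  have h1 : ∫⁻ ω, ENNReal.ofReal (‖r ω‖ ^ (p + 2)) ∂P
      ≤ ENNReal.ofReal (|C| * (Real.sqrt ε ^ (k + 1)) ^ (p + 2)) := by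
    have h2 := hC ε hε
    rw [hpow] at h2
    refine le_trans (le_of_eq ?_) (h2.trans (ENNReal.ofReal_le_ofReal ?_))
    · refine lintegral_congr fun ω => ?_
      rw [ENNReal.ofReal_pow (norm_nonneg _), ofReal_norm, ← ENNReal.rpow_natCast]
      congr 1
      · simp only [hr, rpow_half_eq_sqrt_pow hε.1.le]
      · push_cast; ring
    · gcongr
      exact le_abs_self C
  have hsm : AEStronglyMeasurable (fun ω => ‖r ω‖ ^ (p + 2)) P :=
    (hrm.norm.pow_const _).aestronglyMeasurable
  constructor
  · refine ⟨hsm, ?_⟩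
    rw [hasFiniteIntegral_iff_ofReal (Filter.Eventually.of_forall fun ω => by positivity)]
    exact h1.trans_lt ENNReal.ofReal_lt_top
  · rw [integral_eq_lintegral_of_nonneg_ae (Filter.Eventually.of_forall fun ω => by positivity) hsm]
    exact ENNReal.toReal_le_of_le_ofReal (by positivity) h1

variable {W : ℝ≥0 → Ω → EuclideanSpace ℝ (Fin d)}

theorem SolvesFluctuation.ae_continuous {n : ℕ} {η : ℕ → Ω → EuclideanSpace ℝ (Fin d)}
    {Y : ℕ → ℝ≥0 → Ω → EuclideanSpace ℝ (Fin d)} (hY : SolvesFluctuation P W n η Y) :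
    ∀ᵐ ω ∂P, ∀ m ≤ n, Continuous fun t => Y m t ω := by
  rw [ae_all_iff]
  intro m
  by_cases hm : m ≤ n
  · filter_upwards [(hY m hm).continuous_paths] with ω hω _ using hω
  · exact Filter.Eventually.of_forall fun ω h => absurd h hm

theorem SolvesFluctuation.ae_integral_eq {n : ℕ} {η : ℕ → Ω → EuclideanSpace ℝ (Fin d)}
    {Y : ℕ → ℝ≥0 → Ω → EuclideanSpace ℝ (Fin d)} (hY : SolvesFluctuation P W n η Y) :
    ∀ᵐ ω ∂P, ∀ m ≤ n, ∀ t : ℝ≥0, Y m t ω = η m ω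
      + (∫ s in (0 : ℝ)..t, coeffDrift (fun k => Y k s.toNNReal ω) m) + coeffNoise m • W t ω := by
  rw [ae_all_iff]
  intro m
  by_cases hm : m ≤ n
  · filter_upwards [(hY m hm).integral_eq] with ω hω _ using hω
  · exact Filter.Eventually.of_forall fun ω h => absurd h hm

/-- Induction on m: each step enlarges G by a polynomial in G, |η (m + 1)| and the cubic integral of
W, so all moments survive. -/
theorem SolvesFluctuation.exists_hasAllMoments_bound [IsProbabilityMeasure P]
    (hW : IsBrownianMotion W P) {n : ℕ} {ξ : ℝ → Ω → EuclideanSpace ℝ (Fin d)}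
    {η : ℕ → Ω → EuclideanSpace ℝ (Fin d)} (hη : InitialExpansion P n ξ η)
    {Y : ℕ → ℝ≥0 → Ω → EuclideanSpace ℝ (Fin d)} (hY : SolvesFluctuation P W n η Y) (t : ℝ≥0)
    {m : ℕ} (hm : m ≤ n) :
    ∃ G : Ω → ℝ, HasAllMoments G P ∧ (∀ ω, 0 ≤ G ω) ∧
      ∀ᵐ ω ∂P, ∀ j ≤ m, ∀ s ≤ t, ‖Y j s ω‖ ≤ G ω + 2 * ‖W s ω‖ := by
  induction m with
  | zero =>
    refine ⟨fun ω => Real.exp t * ‖η 0 ω‖, (hη.hasAllMoments_norm hm).const_mul _,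
      fun ω => by positivity, ?_⟩
    filter_upwards [hY.ae_continuous, hY.ae_integral_eq] with ω hc he j hj s hs
    obtain rfl := Nat.le_zero.1 hj
    have := norm_le_of_coeff_zero (y := fun k s => Y k s ω) (w := fun s => W s ω) (hc 0 hm)
      (he 0 hm) hs
    exact this.trans (le_add_of_nonneg_right (by positivity))
  | succ m ih =>
    obtain ⟨G, hG, hG0, hGY⟩ := ih (Nat.le_of_succ_le hm)
    obtain ⟨C, hC, hbound⟩ := exists_norm_le_of_coeff (d := d) (m + 1) (Nat.succ_pos m)
    refine ⟨fun ω => G ω + Real.exp t * (‖η (m + 1) ω‖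
        + C * (1 + G ω) ^ 3 * cubicIntegral (fun s => W s ω) t),
      hG.add (((hη.hasAllMoments_norm hm).add
        (((((HasAllMoments.const 1).add hG).pow 3).const_mul C).mul
          (hW.hasAllMoments_cubicIntegral t))).const_mul _),
      fun ω => ?_, ?_⟩
    · have := hG0 ω
      have := cubicIntegral_nonneg (fun s => W s ω) t
      positivity
    · filter_upwards [hY.ae_continuous, hY.ae_integral_eq, hGY, hW.ae_continuous]
        with ω hc he hb hwc j hj s hs
      have h1 := hG0 ω
      have h2 := cubicIntegral_nonneg (fun s => W s ω) t
      rcases Nat.le_succ_iff.1 hj with hj' | rfl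
      · have h3 := hb j hj' s hs
        have h4 : 0 ≤ Real.exp t * (‖η (m + 1) ω‖
          + C * (1 + G ω) ^ 3 * cubicIntegral (fun s => W s ω) t) := by positivity
        linarith
      · have h3 := hbound (fun k s => Y k s ω) (fun s => W s ω) (η (m + 1) ω) (G ω) t
          (fun i hi => hc i (hi.trans hm)) hwc (he _ hm) h1
          (fun i hi => hb i (Nat.lt_succ_iff.1 hi)) s hs
        linarith

/-- H is chosen before ε; only the exceptional null set depends on ε. The initial remainder stays
separate because only its moments, not its paths, are of order δ^(m+1). -/
theorem SolvesLangevin.exists_norm_sub_sum_le [IsProbabilityMeasure P]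
    (hW : IsBrownianMotion W P) {n : ℕ} {ξ : ℝ → Ω → EuclideanSpace ℝ (Fin d)}
    {η : ℕ → Ω → EuclideanSpace ℝ (Fin d)} (hη : InitialExpansion P n ξ η)
    {X : ℝ → ℝ≥0 → Ω → EuclideanSpace ℝ (Fin d)}
    (hX : ∀ ε ∈ Set.Ioo (0 : ℝ) 1, SolvesLangevin P W ε (ξ ε) (X ε))
    {Y : ℕ → ℝ≥0 → Ω → EuclideanSpace ℝ (Fin d)} (hY : SolvesFluctuation P W n η Y) (t : ℝ≥0)
    {m : ℕ} (hm : m ≤ n) :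
    ∃ H : Ω → ℝ, HasAllMoments H P ∧ (∀ ω, 0 ≤ H ω) ∧ ∀ ε ∈ Set.Ioo (0 : ℝ) 1, ∀ᵐ ω ∂P,
      ‖X ε t ω - ∑ j ∈ Finset.range (m + 1), Real.sqrt ε ^ j • Y j t ω‖
        ≤ Real.exp t * ‖ξ ε ω - ∑ j ∈ Finset.range (m + 1), Real.sqrt ε ^ j • η j ω‖
          + Real.sqrt ε ^ (m + 1) * H ω := by
  obtain ⟨G, hG, hG0, hGY⟩ := hY.exists_hasAllMoments_bound hW hη t hm
  obtain ⟨C, hC, hbound⟩ := exists_norm_sub_truncation_le (d := d) m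
  refine ⟨fun ω => Real.exp t * (C * (1 + G ω) ^ 3 * cubicIntegral (fun s => W s ω) t)
      + (1 + 2 * ‖W t ω‖),
    ((((((HasAllMoments.const 1).add hG).pow 3).const_mul C).mul
      (hW.hasAllMoments_cubicIntegral t)).const_mul _).add (hW.hasAllMoments_norm t),
    fun ω => ?_, fun ε hε => ?_⟩
  · have := hG0 ω
    have := cubicIntegral_nonneg (fun s => W s ω) t
    positivity
  · filter_upwards [hY.ae_continuous, hY.ae_integral_eq, hGY, hW.ae_continuous,
      (hX ε hε).continuous_paths, (hX ε hε).integral_eq] with ω hc he hb hwc hXc hXe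
    have hδ := Real.sqrt_nonneg ε
    have hδ1 : Real.sqrt ε ≤ 1 := Real.sqrt_le_one.2 hε.2.le
    simp only [gradient_potential, neg_neg] at hXe
    rw [mul_comm 2 ε, Real.sqrt_mul hε.1.le] at hXe
    have h1 := hbound (fun s => X ε s ω) (fun k s => Y k s ω) (fun s => W s ω) (ξ ε ω)
      (fun j => η j ω) (Real.sqrt ε) (G ω) t hδ hδ1 hXc (fun i hi => hc i (hi.trans hm)) hwc hXe
      (fun i hi => he i (hi.trans hm)) (hG0 ω) hb
    -- At m = 0 the truncation exceeds the bare expansion by the noise √2 δ W(t), itself of order δ.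
    have h2 : ‖truncation (fun j => Y j t ω) (W t ω) (Real.sqrt ε) m
        - ∑ j ∈ Finset.range (m + 1), Real.sqrt ε ^ j • Y j t ω‖
        ≤ Real.sqrt ε ^ (m + 1) * (1 + 2 * ‖W t ω‖) := by
      rw [truncation, add_sub_cancel_left]
      split_ifs with h0
      · subst h0
        have hs : Real.sqrt 2 ≤ 2 := by
          rw [Real.sqrt_le_left (by norm_num)]; norm_num
        rw [norm_smul, norm_mul, Real.norm_eq_abs, Real.norm_eq_abs, abs_of_nonneg hδ,
          abs_of_nonneg (Real.sqrt_nonneg _), mul_assoc, zero_add, pow_one]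
        gcongr
        linarith [mul_le_mul_of_nonneg_right hs (norm_nonneg (W t ω))]
      · rw [norm_zero]; positivity
    have h3 := norm_sub_le_norm_sub_add_norm_sub (X ε t ω)
      (truncation (fun j => Y j t ω) (W t ω) (Real.sqrt ε) m)
      (∑ j ∈ Finset.range (m + 1), Real.sqrt ε ^ j • Y j t ω)
    refine (h3.trans (add_le_add h1 h2)).trans_eq ?_
    ring

theorem SolvesFluctuation.integrable_weakCoeffIntegrand [IsProbabilityMeasure P]
    (hW : IsBrownianMotion W P) {n : ℕ} {ξ : ℝ → Ω → EuclideanSpace ℝ (Fin d)}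
    {η : ℕ → Ω → EuclideanSpace ℝ (Fin d)} (hη : InitialExpansion P n ξ η)
    {Y : ℕ → ℝ≥0 → Ω → EuclideanSpace ℝ (Fin d)} (hY : SolvesFluctuation P W n η Y)
    {F : EuclideanSpace ℝ (Fin d) → ℝ} (hF : HasPolynomialGrowth (n + 1) F) (t : ℝ≥0)
    {m : ℕ} (hm : m ≤ n) :
    Integrable (fun ω => weakCoeffIntegrand F (fun k => Y k t ω) m) P := by
  obtain ⟨G, hG, hG0, hGY⟩ := hY.exists_hasAllMoments_bound hW hη t hm
  obtain ⟨C, N, hC, hbound⟩ := hF.exists_abs_weakCoeffIntegrand_le hm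
  -- Nothing is known about `Y k` for k > n, so the irrelevant coordinates are replaced by 0 before
  -- measurability is used.
  have hcut : (fun ω => weakCoeffIntegrand F (fun k => Y k t ω) m)
      = fun ω => weakCoeffIntegrand F (fun k => if k ≤ m then Y k t ω else 0) m := by
    ext ω
    exact weakCoeffIntegrand_congr F fun j hj => (if_pos hj).symm
  have hmeas : AEStronglyMeasurable (fun ω => weakCoeffIntegrand F (fun k => Y k t ω) m) P := by
    rw [hcut]
    have hz : AEMeasurable (fun ω (k : ℕ) => if k ≤ m then Y k t ω else 0) P := by
      refine aemeasurable_pi_iff.2 fun k => ?_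
      by_cases hk : k ≤ m
      · simp only [if_pos hk]; exact (hY k (hk.trans hm)).aemeasurable t
      · simp only [if_neg hk]; exact aemeasurable_const
    exact ((continuous_weakCoeffIntegrand hF.1
      (hm.trans n.le_succ)).measurable.comp_aemeasurable hz).aestronglyMeasurable
  refine (((hG.add (hW.hasAllMoments_norm t)).pow N).const_mul C).integrable.mono' hmeas ?_
  filter_upwards [hGY] with ω hω
  refine hbound _ _ ?_ fun j hj => ?_
  · linarith [hG0 ω, norm_nonneg (W t ω)]
  · linarith [hω j hj t le_rfl]

/-- The weak expansion up to a fixed order, in powers of `√ε`. -/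
theorem SolvesLangevin.exists_abs_integral_sub_sum_le [IsProbabilityMeasure P]
    (hW : IsBrownianMotion W P) {n : ℕ} {ξ : ℝ → Ω → EuclideanSpace ℝ (Fin d)}
    (hξ : ∀ ε ∈ Set.Ioo (0 : ℝ) 1, Measurable (ξ ε))
    {η : ℕ → Ω → EuclideanSpace ℝ (Fin d)} (hη : InitialExpansion P n ξ η)
    {X : ℝ → ℝ≥0 → Ω → EuclideanSpace ℝ (Fin d)}
    (hX : ∀ ε ∈ Set.Ioo (0 : ℝ) 1, SolvesLangevin P W ε (ξ ε) (X ε))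
    {Y : ℕ → ℝ≥0 → Ω → EuclideanSpace ℝ (Fin d)} (hY : SolvesFluctuation P W n η Y)
    {F : EuclideanSpace ℝ (Fin d) → ℝ} (hF : HasPolynomialGrowth (n + 1) F) (t : ℝ≥0)
    {m : ℕ} (hm : m ≤ n) :
    ∃ C : ℝ, 0 ≤ C ∧ ∀ ε ∈ Set.Ioo (0 : ℝ) 1, Integrable (fun ω => F (X ε t ω)) P ∧
      |(∫ ω, F (X ε t ω) ∂P) - ∑ k ∈ Finset.range (m + 1), Real.sqrt ε ^ k * weakCoeff P Y F k t|
        ≤ C * Real.sqrt ε ^ (m + 1) := by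
  obtain ⟨G, hG, hG0, hGY⟩ := hY.exists_hasAllMoments_bound hW hη t hm
  obtain ⟨H, hH, hH0, hXH⟩ := SolvesLangevin.exists_norm_sub_sum_le hW hη hX hY t hm
  obtain ⟨C, N, hC, hbound⟩ := hF.exists_abs_sub_sum_weakCoeffIntegrand_le hm
  -- The Taylor degree N decides which moment of the initial remainder is needed; it is raised to N
  -- + 2 since moments are controlled from order 2 on.
  obtain ⟨D, hD, hrem⟩ := hη.exists_integral_norm_pow_le hξ hm N
  set A : Ω → ℝ := fun ω => G ω + (1 + 2 * ‖W t ω‖) + H ω with hA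
  have hAm : HasAllMoments A P := (hG.add (hW.hasAllMoments_norm t)).add hH
  have hA1 : ∀ ω, 1 ≤ A ω := fun ω => by
    simp only [hA]; linarith [hG0 ω, hH0 ω, norm_nonneg (W t ω)]
  refine ⟨C * (2 ^ (N + 2 - 1) * ((∫ ω, A ω ^ (N + 2) ∂P) + Real.exp t ^ (N + 2) * D)), ?_,
    fun ε hε => ?_⟩
  · have : 0 ≤ ∫ ω, A ω ^ (N + 2) ∂P := integral_nonneg fun ω =>
      pow_nonneg (zero_le_one.trans (hA1 ω)) _
    positivity
  set δ := Real.sqrt ε with hδdef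
  have hδ : 0 < δ := Real.sqrt_pos.2 hε.1
  have hδ1 : δ ≤ 1 := Real.sqrt_le_one.2 hε.2.le
  have hδm : 0 < δ ^ (m + 1) := pow_pos hδ _
  set r : Ω → ℝ := fun ω => ‖ξ ε ω - ∑ j ∈ Finset.range (m + 1), δ ^ j • η j ω‖ with hr
  obtain ⟨hri, hrle⟩ := hrem ε hε
  set S : Ω → ℝ := fun ω =>
    ∑ k ∈ Finset.range (m + 1), δ ^ k * weakCoeffIntegrand F (fun k => Y k t ω) k with hS
  have hSi : ∀ k ∈ Finset.range (m + 1),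
      Integrable (fun ω => δ ^ k * weakCoeffIntegrand F (fun k => Y k t ω) k) P := fun k hk =>
    (hY.integrable_weakCoeffIntegrand hW hη hF t
      ((Nat.lt_succ_iff.1 (Finset.mem_range.1 hk)).trans hm)).const_mul _
  have hSint : Integrable S P := integrable_finsetSum _ hSi
  set M : Ω → ℝ := fun ω => C * δ ^ (m + 1) *
    (2 ^ (N + 2 - 1) * (A ω ^ (N + 2)
      + (Real.exp t / δ ^ (m + 1)) ^ (N + 2) * r ω ^ (N + 2))) with hM
  have hMint : Integrable M P :=
    (((hAm.pow (N + 2)).integrable.add (hri.const_mul _)).const_mul _).const_mul _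
  have hpath : ∀ᵐ ω ∂P, |F (X ε t ω) - S ω| ≤ M ω := by
    filter_upwards [hGY, hXH ε hε] with ω hω hωX
    set R : EuclideanSpace ℝ (Fin d) :=
      X ε t ω - ∑ j ∈ Finset.range (m + 1), δ ^ j • Y j t ω with hR
    -- The rescaled remainder takes the slot m + 1, so ∑ δ^j z_j equals X_ε(t) exactly.
    set z : ℕ → EuclideanSpace ℝ (Fin d) :=
      fun j => if j ≤ m then Y j t ω else (δ ^ (m + 1))⁻¹ • R with hz
    set B : ℝ := A ω + Real.exp t / δ ^ (m + 1) * r ω with hB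
    have hr0 : 0 ≤ r ω := norm_nonneg _
    have hρ : 0 ≤ Real.exp t / δ ^ (m + 1) * r ω := by positivity
    have hB1 : 1 ≤ B := by linarith [hA1 ω]
    have hzB : ∀ j ≤ m + 1, ‖z j‖ ≤ B := by
      intro j _
      by_cases hj : j ≤ m
      · simp only [hz, if_pos hj, hB, hA]
        linarith [hω j hj t le_rfl, hH0 ω]
      · simp only [hz, if_neg hj]
        rw [norm_smul, norm_inv, Real.norm_eq_abs, abs_of_pos hδm, inv_mul_le_iff₀ hδm]
        refine hωX.trans ?_
        have h1 : δ ^ (m + 1) * (Real.exp t / δ ^ (m + 1) * r ω) = Real.exp t * r ω := by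
          field_simp
        have h2 : 0 ≤ δ ^ (m + 1) * (G ω + (1 + 2 * ‖W t ω‖)) := by
          have := hG0 ω
          positivity
        simp only [hB, hA, mul_add] at h2 ⊢
        linarith
    have hzX : ∑ j ∈ Finset.range (m + 2), δ ^ j • z j = X ε t ω := by
      rw [Finset.sum_range_succ, Finset.sum_congr rfl fun j hj => by
        rw [show z j = Y j t ω from if_pos (Nat.lt_succ_iff.1 (Finset.mem_range.1 hj))]]
      rw [show z (m + 1) = (δ ^ (m + 1))⁻¹ • R from if_neg (by omega), smul_smul,
        mul_inv_cancel₀ hδm.ne', one_smul, hR]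
      abel
    have hzS : ∑ k ∈ Finset.range (m + 1), δ ^ k * weakCoeffIntegrand F z k = S ω :=
      Finset.sum_congr rfl fun k hk => by
        rw [weakCoeffIntegrand_congr F fun j hj => if_pos
          (hj.trans (Nat.lt_succ_iff.1 (Finset.mem_range.1 hk)))]
    have h1 := hbound z δ B hδ.le hδ1 hB1 hzB
    rw [hzX, hzS] at h1
    refine h1.trans (mul_le_mul_of_nonneg_left ?_ (by positivity))
    refine (pow_le_pow_right₀ hB1 (Nat.le_add_right N 2)).trans ?_
    -- Convexity of the power separates A from the rescaled initial remainder and yields the factor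
    -- 2^(N+1).
    have := add_pow_le (zero_le_one.trans (hA1 ω)) hρ (N + 2)
    rwa [mul_pow] at this
  have hXm : AEStronglyMeasurable (fun ω => F (X ε t ω)) P :=
    (hF.1.continuous.measurable.comp_aemeasurable ((hX ε hε).aemeasurable t)).aestronglyMeasurable
  have hdiff : Integrable (fun ω => F (X ε t ω) - S ω) P :=
    hMint.mono' (hXm.sub hSint.aestronglyMeasurable) hpath
  have hXi : Integrable (fun ω => F (X ε t ω)) P := by
    exact (hdiff.add hSint).congr (Filter.Eventually.of_forall fun ω => sub_add_cancel _ _)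
  refine ⟨hXi, ?_⟩
  have hSsum : ∫ ω, S ω ∂P = ∑ k ∈ Finset.range (m + 1), δ ^ k * weakCoeff P Y F k t := by
    rw [integral_finsetSum _ hSi]
    simp_rw [integral_const_mul]
    rfl
  rw [← hSsum, ← integral_sub hXi hSint]
  have h1 : |∫ ω, (F (X ε t ω) - S ω) ∂P| ≤ ∫ ω, M ω ∂P := by
    rw [← Real.norm_eq_abs]
    exact norm_integral_le_of_norm_le hMint hpath
  refine h1.trans ?_
  simp only [hM]
  rw [integral_const_mul, integral_const_mul, integral_add (hAm.pow (N + 2)).integrable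
    (hri.const_mul _), integral_const_mul]
  -- The moment of r is of order (δ^(m+1))^(N+2), exactly what the rescaling divides by.
  have h2 : (Real.exp t / δ ^ (m + 1)) ^ (N + 2) * ∫ ω, r ω ^ (N + 2) ∂P
      ≤ Real.exp t ^ (N + 2) * D := by
    refine (mul_le_mul_of_nonneg_left hrle (by positivity)).trans_eq ?_
    rw [div_pow]
    field_simp
    exact mul_comm _ _
  calc _ ≤ C * δ ^ (m + 1) * (2 ^ (N + 2 - 1) *
        ((∫ ω, A ω ^ (N + 2) ∂P) + Real.exp t ^ (N + 2) * D)) := by gcongr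
    _ = _ := by ring

end WeakExpansion

end DoubleWell

theorem proposition1p2 {d : ℕ} (n : ℕ)
    {Ω : Type*} [MeasurableSpace Ω] (P : Measure Ω) [IsProbabilityMeasure P]
    (W : ℝ≥0 → Ω → EuclideanSpace ℝ (Fin d)) (hW : DoubleWell.IsBrownianMotion W P)
    (ξ : ℝ → Ω → EuclideanSpace ℝ (Fin d))
    (hξ : ∀ ε ∈ Set.Ioo (0 : ℝ) 1, Measurable (ξ ε))
    (hξW : ∀ ε ∈ Set.Ioo (0 : ℝ) 1, IndepFun (ξ ε) (fun ω (t : ℝ≥0) => W t ω) P)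
    (η : ℕ → Ω → EuclideanSpace ℝ (Fin d)) (hη : DoubleWell.InitialExpansion P n ξ η)
    (X : ℝ → ℝ≥0 → Ω → EuclideanSpace ℝ (Fin d))
    (hX : ∀ ε ∈ Set.Ioo (0 : ℝ) 1, DoubleWell.SolvesLangevin P W ε (ξ ε) (X ε))
    (Y : ℕ → ℝ≥0 → Ω → EuclideanSpace ℝ (Fin d))
    (hY : DoubleWell.SolvesFluctuation P W n η Y)
    (F : EuclideanSpace ℝ (Fin d) → ℝ) (hF : DoubleWell.HasPolynomialGrowth (n + 1) F)
    (t : ℝ≥0) (ht : 0 < t) :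
    (∀ ε ∈ Set.Ioo (0 : ℝ) 1, Integrable (fun ω => F (X ε t ω)) P) ∧
    (∀ m ≤ n, Integrable
      (fun ω => DoubleWell.weakCoeffIntegrand F (fun k => Y k t ω) m) P) ∧
    ∃ C : ℝ, 0 < C ∧ ∀ ε ∈ Set.Ioo (0 : ℝ) 1, ∀ m ≤ n,
      |((∫ ω, F (X ε t ω) ∂P)
          - ∑ k ∈ Finset.range (m + 1), ε ^ ((k : ℝ) / 2) * DoubleWell.weakCoeff P Y F k t)
        / ε ^ ((m : ℝ) / 2)| ≤ C * ε ^ ((1 : ℝ) / 2) := by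
  have hmain := fun m (hm : m ≤ n) =>
    DoubleWell.SolvesLangevin.exists_abs_integral_sub_sum_le hW hξ hη hX hY hF t hm
  choose! C hC0 hC using hmain
  -- Summing the nonnegative constants of all orders gives one valid for every m ≤ n; adding 1 makes
  -- it positive.
  refine ⟨fun ε hε => (hC 0 (Nat.zero_le n) ε hε).1,
    fun m hm => hY.integrable_weakCoeffIntegrand hW hη hF t hm,
    (∑ m ∈ Finset.range (n + 1), C m) + 1, ?_, fun ε hε m hm => ?_⟩
  · have : 0 ≤ ∑ m ∈ Finset.range (n + 1), C m := Finset.sum_nonneg fun m hm =>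
      hC0 m (Nat.lt_succ_iff.1 (Finset.mem_range.1 hm))
    linarith
  · have hle : C m ≤ (∑ m ∈ Finset.range (n + 1), C m) + 1 :=
      (Finset.single_le_sum (f := C) (fun m hm => hC0 m
        (Nat.lt_succ_iff.1 (Finset.mem_range.1 hm)))
        (Finset.mem_range.2 (Nat.lt_succ_iff.2 hm))).trans (by linarith)
    have hδ : 0 < Real.sqrt ε := Real.sqrt_pos.2 hε.1
    have h := (hC m hm ε hε).2
    simp_rw [DoubleWell.rpow_half_eq_sqrt_pow hε.1.le]
    rw [← Real.sqrt_eq_rpow, abs_div, abs_of_pos (pow_pos hδ m), div_le_iff₀ (pow_pos hδ m)]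
    refine h.trans ?_
    rw [pow_succ', ← mul_assoc]
    gcongr
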